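/- **Lemma 4.1 (simultaneous search).** Let $n$ be the security parameter. A QPT algorithm is a (non-uniform) family of quantum circuits, one for each $n$, of size polynomial in $n$, over arbitrary one-qubit unitary gates, CNOT and Toffoli gates, with ancilla qubits initialized to $|0\rangle$ and with tracing out of qubits. Write $\approx_c$ for computational indistinguishability: every QPT distinguisher with one output bit has advantage negligible in $n$. An unbounded quantum algorithm with one output bit is an arbitrary two-outcome measurement for each $n$. Let $\mathcal{D}$ be an arbitrary distribution (for each $n$) outputting a possibly entangled state of three finite registers of qubits $(\mathcal{A},\mathcal{B},\mathcal{C})$ along with a classical string $k_C$. Let $\mathcal{D}'$ be a QPT-samplable distribution taking $k_C$ as input and outputting a register $\mathcal{C}'$ of the same size as $\mathcal{C}$, such that $$\{(\mathcal{A},\mathcal{C},k_C) : (\mathcal{A},\mathcal{B},\mathcal{C},k_C)\gets\mathcal{D}\}\ \approx_c\ \{(\mathcal{A},\mathcal{C}',k_C) : (\mathcal{A},\mathcal{B},\mathcal{C},k_C)\gets\mathcal{D},\ \mathcal{C}'\gets\mathcal{D}'(k_C)\}.$$ Then for all QPT algorithms $(A,C)$ and all (unbounded) quantum algorithms $B$: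 if there is a positive polynomial $p$ such that for all sufficiently large $n$ $$\Pr\left[1\gets B(\mathcal{B},\mathcal{A}_B)\ \wedge\ 1\gets C(\mathcal{C},k_C,\mathcal{A}_C)\ :\ (\mathcal{A},\mathcal{B},\mathcal{C},k_C)\gets\mathcal{D},\ (\mathcal{A}_B,\mathcal{A}_C)\gets A(\mathcal{A})\right]\ \ge\ \frac{1}{p(n)},$$ then there is a positive polynomial $q$ such that for all sufficiently large $n$ $$\Pr\left[1\gets B(\mathcal{B},\mathcal{A}_B)\ \wedge\ 1\gets C(\mathcal{C}',k_C,\mathcal{A}_C)\ :\ (\mathcal{A},\mathcal{B},\mathcal{C},k_C)\gets\mathcal{D},\ (\mathcal{A}_B,\mathcal{A}_C)\gets A(\mathcal{A}),\ \mathcal{C}'\gets\mathcal{D}'(k_C)\right]\ \ge\ \frac{1}{q(n)}.$$ -/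

import Mathlib

open Filter Matrix
open scoped Kronecker ComplexOrder

noncomputable section

/-- Computational basis (bit strings) of a register whose qubits are labelled by `W`. -/
abbrev Bits (W : Type) : Type := W → Bool

/-- The elementary gates: an arbitrary one-qubit unitary on wire `i`, CNOT (control `i`,
target `j`) and Toffoli (controls `i`, `j`, target `k`), acting on distinct named wires. -/
inductive QGate (W : Type) : Type
  | one (i : W) (U : Matrix.unitaryGroup Bool ℂ)
  | cnot (i j : W) (hij : i ≠ j)
  | toffoli (i j k : W) (hij : i ≠ j) (hik : i ≠ k) (hjk : j ≠ k)

/-- The matrix of a gate on all wires in `W`, in the computational basis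
(rows are outputs, columns are inputs). -/
def QGate.matrix {W : Type} [Fintype W] [DecidableEq W] :
    QGate W → Matrix (Bits W) (Bits W) ℂ
  | .one i U => Matrix.of fun u v =>
      if ∀ j, j ≠ i → u j = v j then (U : Matrix Bool Bool ℂ) (u i) (v i) else 0
  | .cnot i j _ => Matrix.of fun u v =>
      if u = Function.update v j (xor (v j) (v i)) then 1 else 0
  | .toffoli i j k _ _ _ => Matrix.of fun u v =>
      if u = Function.update v k (xor (v k) (v i && v j)) then 1 else 0

/-- The unitary of a sequence of gates; the head of the list is applied first. -/
def circuitUnitary {W : Type} [Fintype W] [DecidableEq W] (gs : List (QGate W)) :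
    Matrix (Bits W) (Bits W) ℂ :=
  gs.foldl (fun U g => g.matrix * U) 1

/-- A quantum circuit with input register `I` and output register `O`: adjoin `anc` ancilla
qubits in state `|0⟩`, apply a list of gates, and finally split the wires (by `out`) into the
output register and `disc` discarded wires, which are traced out. -/
structure QAlg (I O : Type) where
  anc : ℕ
  disc : ℕ
  gates : List (QGate (I ⊕ Fin anc))
  out : O ⊕ Fin disc ≃ I ⊕ Fin anc

namespace QAlg

variable {I O : Type} [Fintype I] [DecidableEq I] [Fintype O] [DecidableEq O]

/-- Number of wires plus number of gates. -/
def size (M : QAlg I O) : ℕ := Fintype.card I + M.anc + M.gates.length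

/-- The Kraus operator of the circuit belonging to the value `d` of the discarded wires. -/
def kraus (M : QAlg I O) (d : Bits (Fin M.disc)) : Matrix (Bits O) (Bits I) ℂ :=
  Matrix.of fun o i =>
    circuitUnitary M.gates (Sum.elim o d ∘ M.out.symm) (Sum.elim i fun _ => false)

/-- The output state of the circuit on an input state of the register `I`. -/
def run (M : QAlg I O) (ρ : Matrix (Bits I) (Bits I) ℂ) : Matrix (Bits O) (Bits O) ℂ :=
  ∑ d, M.kraus d * ρ * (M.kraus d)ᴴ

/-- The circuit applied to the register `I` of a joint state of `I` and an environment `E`. -/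
def runWith (M : QAlg I O) {E : Type} [Fintype E] [DecidableEq E]
    (ρ : Matrix (Bits I × E) (Bits I × E) ℂ) : Matrix (Bits O × E) (Bits O × E) ℂ :=
  ∑ d, (M.kraus d ⊗ₖ (1 : Matrix E E ℂ)) * ρ * (M.kraus d ⊗ₖ (1 : Matrix E E ℂ))ᴴ

/-- For a circuit with one output qubit, measured in the computational basis: the effect
(POVM element) of the outcome `1`, so that `Pr[1 ← M(ρ)] = tr (M.accept * ρ)`. -/
def accept (M : QAlg I Unit) : Matrix (Bits I) (Bits I) ℂ :=
  ∑ d, (M.kraus d)ᴴ *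
    Matrix.single (fun _ : Unit => true) (fun _ : Unit => true) (1 : ℂ) * M.kraus d

end QAlg

/-- Quantum polynomial time, as a function of the security parameter `n`: a family of quantum
circuits, one for each `n`, whose size is bounded by a polynomial in `n`. -/
def IsQPT {I O : ℕ → Type} [∀ n, Fintype (I n)] (M : ∀ n, QAlg (I n) (O n)) : Prop :=
  ∃ P : Polynomial ℕ, ∀ n, (M n).size ≤ P.eval n

/-- An unbounded quantum algorithm that takes the register `W` as input and outputs one bit:
an arbitrary two-outcome measurement `{effect, 1 - effect}`, `effect` being the outcome `1`. -/
structure QTest (W : Type) [Fintype W] [DecidableEq W] where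
  effect : Matrix (Bits W) (Bits W) ℂ
  posSemidef : effect.PosSemidef
  one_sub_posSemidef : (1 - effect).PosSemidef

/-- Operators on registers `A`, `B`, `C` of `a`, `b`, `c` qubits, one for each string
`k` of `l` bits. -/
abbrev CQOp (a b c l : ℕ) : Type :=
  Bits (Fin l) →
    Matrix (Bits (Fin a) × Bits (Fin b) × Bits (Fin c))
      (Bits (Fin a) × Bits (Fin b) × Bits (Fin c)) ℂ

/-- `ρ` describes a distribution outputting a (possibly entangled) state of three registers
along with a classical string: `ρ k` is the probability of the string `k` times the density
matrix of `(A, B, C)` conditioned on `k`. -/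
def CQOp.IsState {a b c l : ℕ} (ρ : CQOp a b c l) : Prop :=
  (∀ k, (ρ k).PosSemidef) ∧ ∑ k, (ρ k).trace = 1

/-- Sample `(A, B, C, k)` from `ρ`, discard `C`, and put a fresh sample `C' ← D' k` in its
place. -/
def CQOp.replaceC {a b c l : ℕ} (ρ : CQOp a b c l) (D' : QAlg (Fin l) (Fin c)) :
    CQOp a b c l :=
  fun k => Matrix.of fun u v =>
    (∑ z, ρ k (u.1, u.2.1, z) (v.1, v.2.1, z)) * D'.run (Matrix.single k k 1) u.2.2 v.2.2

/-- `Pr[1 ← M(A, C, k) : (A, B, C, k) ← ρ]`. -/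
def CQOp.viewProb {a b c l : ℕ} (ρ : CQOp a b c l)
    (M : QAlg (Fin a ⊕ Fin c ⊕ Fin l) Unit) : ℝ :=
  ∑ k,
    -- the state of the registers `A` and `C`, jointly with the string being `k`
    let ρAC : Matrix (Bits (Fin a) × Bits (Fin c)) (Bits (Fin a) × Bits (Fin c)) ℂ :=
      Matrix.of fun u v => ∑ y, ρ k (u.1, y, u.2) (v.1, y, v.2)
    -- the effect on `A` and `C` of running `M` with the classical string `k`
    let test : Matrix (Bits (Fin a) × Bits (Fin c)) (Bits (Fin a) × Bits (Fin c)) ℂ :=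
      M.accept.submatrix (fun u => Sum.elim u.1 (Sum.elim u.2 k))
        (fun u => Sum.elim u.1 (Sum.elim u.2 k))
    (test * ρAC).trace.re

/-- The probability that `B(B, A_B)` and `C(C, k, A_C)` both output `1`, where
`(A, B, C, k) ← ρ` and `(A_B, A_C) ← A(A)`. -/
def CQOp.simultProb {a b c l aB aC : ℕ} (ρ : CQOp a b c l)
    (algA : QAlg (Fin a) (Fin aB ⊕ Fin aC))
    (algB : QTest (Fin b ⊕ Fin aB))
    (algC : QAlg (Fin c ⊕ Fin l ⊕ Fin aC) Unit) : ℝ :=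
  ∑ k,
    -- arrange the final registers `(A_B A_C, B, C)` and the string `k` as the pair of
    -- inputs `(B, A_B)` and `(C, k, A_C)`
    let arrange : Bits (Fin aB ⊕ Fin aC) × Bits (Fin b) × Bits (Fin c) →
        Bits (Fin b ⊕ Fin aB) × Bits (Fin c ⊕ Fin l ⊕ Fin aC) :=
      fun u => (Sum.elim u.2.1 (u.1 ∘ Sum.inl),
        Sum.elim u.2.2 (Sum.elim k (u.1 ∘ Sum.inr)))
    ((algB.effect ⊗ₖ algC.accept).submatrix arrange arrange * algA.runWith (ρ k)).trace.re

/-- A negligible function of the security parameter. -/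
def Negligible (f : ℕ → ℝ) : Prop :=
  Asymptotics.SuperpolynomialDecay atTop (fun n : ℕ => (n : ℝ)) f

/-- Computational indistinguishability of the ensembles `(A, C, k)` obtained from `ρ` and from
`σ`: every QPT distinguisher has negligible advantage. -/
def CompIndist {a b c l : ℕ → ℕ} (ρ σ : ∀ n, CQOp (a n) (b n) (c n) (l n)) : Prop :=
  ∀ M : ∀ n, QAlg (Fin (a n) ⊕ Fin (c n) ⊕ Fin (l n)) Unit, IsQPT M →
    Negligible fun n => |(ρ n).viewProb (M n) - (σ n).viewProb (M n)|

end

/-! ### Operator inequalities behind the guarded test. -/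

section LinearAlgebra

variable {m β γ α δ : Type} [Fintype m] [DecidableEq m] [Fintype β] [DecidableEq β]
  [Fintype γ] [DecidableEq γ] [Fintype α] [DecidableEq α] [Fintype δ]

/-! Fix the string `k`. Let `E` be the effect of the algorithm C on the registers (C, A_C), and let
`P` be the effect on A_C obtained by averaging `E` over a fresh sample C'. The modified experiment
succeeds with the expectation of B ⊗ 1 ⊗ P in the original state, so the question is whether A_C can
pass C on the real register while P is almost never satisfied jointly with B. A distinguisher that
sees only (A, C, k) detects this: it runs A, applies `T` times the operator Q = 1 - 1 ⊗ P ("a fresh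
sample would be rejected"), and then runs C. Its effect is the guarded test F = Q^T E Q^T.

Two inequalities carry the proof. By `posSemidef_gentle`, E ≤ 2F + 2T(1 - Q). Tensoring with B, and
enlarging B to 1 only in the first term, gives `trace_kronecker_le`: real success is at most 2 Pr[F]
+ 2T times the modified success. On a fresh sample F averages to (1 - P)^T P (1 - P)^T ≤ 1/(2T + 1),
which is `trace_guarded_replaceState_le`. Indistinguishability transfers this bound to the real
register up to a negligible error, and T = 4p leaves modified success at least 1/(16p²).

The other half is efficiency. An operator is `Realizable` if it arises from zero ancillas, gates and
projections of wires onto zero. These operators are closed under adjoints and products, with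
additive cost, so 1 - P = K†K and its T-th power cost only a factor linear in T.
`Realizable.exists_qalg` turns such an operator R into a genuine circuit with effect R†R. -/

theorem Matrix.PosSemidef.trace_mul_nonneg {X Y : Matrix m m ℂ} (hX : X.PosSemidef)
    (hY : Y.PosSemidef) : 0 ≤ (X * Y).trace.re := by
  classical
  open scoped MatrixOrder in
  obtain ⟨a, rfl⟩ := CStarAlgebra.nonneg_iff_eq_star_mul_self.mp hX.nonneg
  rw [Matrix.mul_assoc, Matrix.trace_mul_comm, star_eq_conjTranspose]
  exact (Complex.nonneg_iff.mp (hY.mul_mul_conjTranspose_same a).trace_nonneg).1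

theorem trace_mul_re_mono {X X' Y : Matrix m m ℂ} (hX : (X' - X).PosSemidef)
    (hY : Y.PosSemidef) : (X * Y).trace.re ≤ (X' * Y).trace.re := by
  have := hX.trace_mul_nonneg hY
  rw [Matrix.sub_mul, Matrix.trace_sub, Complex.sub_re] at this
  linarith

theorem kronecker_sub' (A : Matrix m m ℂ) (X Y : Matrix α α ℂ) :
    A ⊗ₖ (X - Y) = A ⊗ₖ X - A ⊗ₖ Y := by
  ext u v
  simp [mul_sub]

/-- A real polynomial that is nonnegative on `[0, 1]` is positive semidefinite at any matrix
between `0` and `1`. -/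
theorem posSemidef_aeval {Q : Matrix m m ℂ} (hQ : Q.PosSemidef) (hQ1 : (1 - Q).PosSemidef)
    (f : Polynomial ℝ) (hf : ∀ x : ℝ, 0 ≤ x → x ≤ 1 → 0 ≤ f.eval x) :
    (Polynomial.aeval Q f).PosSemidef := by
  open scoped MatrixOrder in
  have hsa : IsSelfAdjoint Q := hQ.1
  have h0 : (0 : Matrix m m ℂ) ≤ Q := hQ.nonneg
  have h1 : Q ≤ 1 := Matrix.le_iff.mpr hQ1
  have hsp := (CFC.le_one_iff (R := ℝ) Q hsa).mp h1
  have hsp0 := (StarOrderedRing.nonneg_iff_spectrum_nonneg (R := ℝ) Q hsa).mp h0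
  rw [← Matrix.nonneg_iff_posSemidef, ← cfc_polynomial f Q hsa]
  exact cfc_nonneg fun x hx => hf x (hsp0 x hx) (hsp x hx)

/-- By functional calculus this is the scalar chain (1 - x^T)² ≤ 1 - x^T ≤ T(1 - x) on [0, 1], the
last step being Bernoulli's inequality. -/
theorem posSemidef_mul_one_sub_sub_sq {Q : Matrix m m ℂ} (hQ : Q.PosSemidef)
    (hQ1 : (1 - Q).PosSemidef) (T : ℕ) :
    ((T : ℝ) • (1 - Q) - (1 - Q ^ T) * (1 - Q ^ T)).PosSemidef := by
  have h := posSemidef_aeval hQ hQ1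
    ((T : ℝ) • (1 - Polynomial.X) - (1 - Polynomial.X ^ T) * (1 - Polynomial.X ^ T)) (by
      intro x hx hx1
      have hb := one_add_mul_le_pow (a := x - 1) (by linarith) T
      have e : 1 + (x - 1) = x := by ring
      rw [e] at hb
      have hp1 : x ^ T ≤ 1 := pow_le_one₀ hx hx1
      have hp0 : 0 ≤ x ^ T := pow_nonneg hx T
      simp only [Polynomial.eval_sub, Polynomial.eval_smul, Polynomial.eval_mul,
        Polynomial.eval_one, Polynomial.eval_pow, Polynomial.eval_X, smul_eq_mul]
      nlinarith)
  simpa using h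

/-- On [0, 1] the powers of x decrease, so (2T + 1) x^(2T) is at most the geometric sum of 2T + 1
terms, and multiplying by 1 - x leaves 1 - x^(2T+1) ≤ 1. -/
theorem posSemidef_smul_one_sub_pow {Q : Matrix m m ℂ} (hQ : Q.PosSemidef)
    (hQ1 : (1 - Q).PosSemidef) (T : ℕ) :
    ((1 / (2 * T + 1) : ℝ) • (1 : Matrix m m ℂ) - Q ^ T * (1 - Q) * Q ^ T).PosSemidef := by
  have h := posSemidef_aeval hQ hQ1
    ((1 / (2 * T + 1) : ℝ) • (1 : Polynomial ℝ) -
      Polynomial.X ^ T * (1 - Polynomial.X) * Polynomial.X ^ T) (by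
      intro x hx hx1
      have hs := mul_neg_geom_sum x (2 * T + 1)
      have hle : ((2 * T + 1 : ℕ) : ℝ) * x ^ (2 * T) ≤
          ∑ i ∈ Finset.range (2 * T + 1), x ^ i := by
        rw [← nsmul_eq_mul]
        have := Finset.card_nsmul_le_sum (Finset.range (2 * T + 1)) (fun i => x ^ i)
          (x ^ (2 * T)) (fun i hi => pow_le_pow_of_le_one hx hx1 (by
            have := Finset.mem_range.mp hi; omega))
        simpa using this
      have hp0 : 0 ≤ x ^ (2 * T + 1) := pow_nonneg hx _
      have hmul : (1 - x) * (((2 * T + 1 : ℕ) : ℝ) * x ^ (2 * T)) ≤ 1 := by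
        calc _ ≤ (1 - x) * ∑ i ∈ Finset.range (2 * T + 1), x ^ i :=
              mul_le_mul_of_nonneg_left hle (by linarith)
          _ ≤ 1 := by rw [hs]; linarith
      simp only [Polynomial.eval_sub, Polynomial.eval_smul, Polynomial.eval_mul,
        Polynomial.eval_one, Polynomial.eval_pow, Polynomial.eval_X, smul_eq_mul, mul_one]
      rw [sub_nonneg, le_div_iff₀ (by positivity)]
      push_cast at hmul
      calc x ^ T * (1 - x) * x ^ T * (2 * T + 1) = (1 - x) * ((2 * T + 1) * x ^ (2 * T)) := by
            ring
        _ ≤ 1 := hmul)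
  simpa using h

/-- `E ≤ 2 Q^T E Q^T + 2 T (1 - Q)` for an effect `E` and `0 ≤ Q ≤ 1`. -/
theorem posSemidef_gentle {Q E : Matrix m m ℂ} (hQ : Q.PosSemidef)
    (hQ1 : (1 - Q).PosSemidef) (hE : E.PosSemidef) (hE1 : (1 - E).PosSemidef) (T : ℕ) :
    ((2 : ℝ) • (Q ^ T * E * Q ^ T) + (2 * T : ℝ) • (1 - Q) - E).PosSemidef := by
  have hK : (Q ^ T)ᴴ = Q ^ T := (hQ.1.pow T)
  have hK1 : (1 - Q ^ T)ᴴ = 1 - Q ^ T := by rw [conjTranspose_sub, hK, conjTranspose_one]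
  -- With K = Q^T, the identity 2KEK + 2(1 - K)E(1 - K) - E = (2K - 1)E(2K - 1) gives positivity.
  -- The second term is then bounded through (1 - K)E(1 - K) ≤ (1 - K)² ≤ T(1 - Q).
  have a := hE.conjTranspose_mul_mul_same (Q ^ T - (1 - Q ^ T))
  have b := hE1.conjTranspose_mul_mul_same (1 - Q ^ T)
  have c := posSemidef_mul_one_sub_sub_sq hQ hQ1 T
  rw [conjTranspose_sub, hK1, hK] at a
  rw [hK1] at b
  convert (a.add (b.add b)).add (c.add c) using 1
  rw [mul_smul, two_smul, two_smul]
  noncomm_ring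

/-- Prepare the vector `ψ` in a new register. -/
def prepare (α : Type) [DecidableEq α] (ψ : γ → ℂ) : Matrix (γ × α) α ℂ :=
  Matrix.of fun u a => if u.2 = a then ψ u.1 else 0

/-- Average of an effect on `γ × α` over a mixture of the pure states `ψ d` on `γ`. -/
def averageEffect (ψ : δ → γ → ℂ) (Y : Matrix (γ × α) (γ × α) ℂ) : Matrix α α ℂ :=
  ∑ d, (prepare α (ψ d))ᴴ * Y * prepare α (ψ d)

/-- Discard the register `γ` and replace it by a mixture of the pure states `ψ d`. -/
def replaceState (τ : Matrix (β × (γ × α)) (β × (γ × α)) ℂ) (ψ : δ → γ → ℂ) :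
    Matrix (β × (γ × α)) (β × (γ × α)) ℂ :=
  Matrix.of fun u v => (∑ z, τ (u.1, (z, u.2.2)) (v.1, (z, v.2.2))) *
    ∑ d, ψ d u.2.1 * star (ψ d v.2.1)

theorem averageEffect_apply (ψ : δ → γ → ℂ) (Y : Matrix (γ × α) (γ × α) ℂ) (a a' : α) :
    averageEffect ψ Y a a' =
      ∑ d, ∑ z, ∑ z', star (ψ d z) * Y (z, a) (z', a') * ψ d z' := by
  simp only [averageEffect, Matrix.sum_apply, Matrix.mul_apply, prepare, conjTranspose_apply,
    of_apply, Fintype.sum_prod_type, apply_ite star, star_zero, ite_mul, zero_mul,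
    mul_ite, mul_zero, Finset.sum_ite_eq', Finset.mem_univ, if_true, Finset.sum_mul]
  exact Finset.sum_congr rfl fun d _ => Finset.sum_comm

/-- Heisenberg picture of the replacement: the modified experiment becomes a measurement of the
original state, so both experiments can be compared by operator inequalities. -/
theorem trace_mul_replaceState (X : Matrix β β ℂ) (Y : Matrix (γ × α) (γ × α) ℂ)
    (τ : Matrix (β × (γ × α)) (β × (γ × α)) ℂ) (ψ : δ → γ → ℂ) :
    ((X ⊗ₖ Y) * replaceState τ ψ).trace =
      ((X ⊗ₖ ((1 : Matrix γ γ ℂ) ⊗ₖ averageEffect ψ Y)) * τ).trace := by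
  simp only [Matrix.trace, Matrix.diag, Matrix.mul_apply, kroneckerMap_apply, replaceState,
    of_apply, Fintype.sum_prod_type, Matrix.one_apply, ite_mul, one_mul,
    zero_mul, mul_ite, mul_zero, Finset.sum_ite_irrel, Finset.sum_const_zero,
    Finset.sum_ite_eq, Finset.mem_univ, if_true]
  refine Finset.sum_congr rfl fun b _ => ?_
  rw [Finset.sum_comm]
  conv_rhs => rw [Finset.sum_comm]
  refine Finset.sum_congr rfl fun a _ => ?_
  rw [Finset.sum_comm]
  conv_rhs => rw [Finset.sum_comm]
  refine Finset.sum_congr rfl fun b' _ => ?_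
  conv_rhs => rw [Finset.sum_comm]
  simp_rw [Finset.sum_comm (s := (Finset.univ : Finset γ)) (t := (Finset.univ : Finset α))]
  refine Finset.sum_congr rfl fun a' _ => ?_
  rw [← Finset.mul_sum, averageEffect_apply]
  simp_rw [← mul_assoc, mul_right_comm _ (∑ z, τ _ _) (∑ d, _)]
  simp_rw [← Finset.sum_mul]
  congr 1
  simp_rw [mul_assoc, ← Finset.mul_sum]
  congr 1
  simp_rw [Finset.mul_sum]
  conv_rhs => rw [Finset.sum_comm]
  refine Finset.sum_congr rfl fun z _ => ?_
  conv_rhs => rw [Finset.sum_comm]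
  refine Finset.sum_congr rfl fun z' _ => Finset.sum_congr rfl fun d _ => ?_
  ring

theorem averageEffect_one (ψ : δ → γ → ℂ) (hψ : ∑ d, ∑ z, star (ψ d z) * ψ d z = 1) :
    averageEffect ψ (1 : Matrix (γ × α) (γ × α) ℂ) = 1 := by
  ext a a'
  rw [averageEffect_apply]
  by_cases h : a = a'
  · subst h
    simpa [Matrix.one_apply] using hψ
  · simp [Matrix.one_apply, h]

theorem averageEffect_sub (ψ : δ → γ → ℂ) (X Y : Matrix (γ × α) (γ × α) ℂ) :
    averageEffect ψ (X - Y) = averageEffect ψ X - averageEffect ψ Y := by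
  simp [averageEffect, Matrix.mul_sub, Matrix.sub_mul]

theorem averageEffect_posSemidef (ψ : δ → γ → ℂ) {Y : Matrix (γ × α) (γ × α) ℂ}
    (hY : Y.PosSemidef) : (averageEffect ψ Y).PosSemidef :=
  Matrix.posSemidef_sum _ fun d _ => hY.conjTranspose_mul_mul_same _

theorem one_kronecker_mul_prepare (K : Matrix α α ℂ) (ψ : γ → ℂ) :
    ((1 : Matrix γ γ ℂ) ⊗ₖ K) * prepare α ψ = prepare α ψ * K := by
  ext ⟨z, a⟩ a'
  simp [Matrix.mul_apply, prepare, Fintype.sum_prod_type, Matrix.one_apply, mul_comm]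

/-- `K` does not touch `γ`, so it commutes with preparing a state there. This is how the guard
passes through the average over fresh samples. -/
theorem averageEffect_conj (ψ : δ → γ → ℂ) (Y : Matrix (γ × α) (γ × α) ℂ)
    {K : Matrix α α ℂ} (hK : Kᴴ = K) :
    averageEffect ψ (((1 : Matrix γ γ ℂ) ⊗ₖ K) * Y * ((1 : Matrix γ γ ℂ) ⊗ₖ K)) =
      K * averageEffect ψ Y * K := by
  have h : ∀ d, (prepare α (ψ d))ᴴ * ((1 : Matrix γ γ ℂ) ⊗ₖ K) = K * (prepare α (ψ d))ᴴ := by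
    intro d
    have := congrArg conjTranspose (one_kronecker_mul_prepare K (ψ d))
    simpa [conjTranspose_mul, conjTranspose_kronecker, hK] using this
  simp only [averageEffect, Finset.mul_sum, Finset.sum_mul]
  refine Finset.sum_congr rfl fun d _ => ?_
  calc _ = ((prepare α (ψ d))ᴴ * ((1 : Matrix γ γ ℂ) ⊗ₖ K)) * Y *
        (((1 : Matrix γ γ ℂ) ⊗ₖ K) * prepare α (ψ d)) := by simp only [Matrix.mul_assoc]
    _ = _ := by rw [h, one_kronecker_mul_prepare]; simp only [Matrix.mul_assoc]

theorem one_kronecker_pow (K : Matrix α α ℂ) (T : ℕ) :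
    ((1 : Matrix γ γ ℂ) ⊗ₖ K) ^ T = (1 : Matrix γ γ ℂ) ⊗ₖ (K ^ T) := by
  induction T with
  | zero => simp
  | succ T ih => rw [pow_succ, ih, ← Matrix.mul_kronecker_mul, pow_succ, Matrix.one_mul]

/-- The analytic core of the simultaneous search lemma: the real success probability is bounded
by that of the guarded test plus that with the replaced register. -/
theorem trace_kronecker_le {B : Matrix β β ℂ} (hB : B.PosSemidef) (hB1 : (1 - B).PosSemidef)
    {E : Matrix (γ × α) (γ × α) ℂ} (hE : E.PosSemidef) (hE1 : (1 - E).PosSemidef)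
    {τ : Matrix (β × (γ × α)) (β × (γ × α)) ℂ} (hτ : τ.PosSemidef)
    (ψ : δ → γ → ℂ) (hψ : ∑ d, ∑ z, star (ψ d z) * ψ d z = 1) (T : ℕ) :
    ((B ⊗ₖ E) * τ).trace.re ≤
      2 * (((1 : Matrix β β ℂ) ⊗ₖ
        ((1 - (1 : Matrix γ γ ℂ) ⊗ₖ averageEffect ψ E) ^ T * E *
          (1 - (1 : Matrix γ γ ℂ) ⊗ₖ averageEffect ψ E) ^ T)) * τ).trace.re +
      2 * T * ((B ⊗ₖ E) * replaceState τ ψ).trace.re := by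
  rw [trace_mul_replaceState]
  set P := averageEffect ψ E with hP
  have hPp : P.PosSemidef := averageEffect_posSemidef ψ hE
  have hP1 : (1 - P).PosSemidef := by
    rw [hP, ← averageEffect_one (α := α) ψ hψ, ← averageEffect_sub]
    exact averageEffect_posSemidef ψ hE1
  set Q : Matrix (γ × α) (γ × α) ℂ := 1 - (1 : Matrix γ γ ℂ) ⊗ₖ P with hQ
  have hQ' : Q = (1 : Matrix γ γ ℂ) ⊗ₖ (1 - P) := by
    rw [hQ, kronecker_sub', Matrix.one_kronecker_one]
  have hQp : Q.PosSemidef := by rw [hQ']; exact Matrix.PosSemidef.one.kronecker hP1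
  have hQ1' : 1 - Q = (1 : Matrix γ γ ℂ) ⊗ₖ P := by rw [hQ]; abel
  have hQ1 : (1 - Q).PosSemidef := by rw [hQ1']; exact Matrix.PosSemidef.one.kronecker hPp
  have hQT : (Q ^ T)ᴴ = Q ^ T := hQp.1.pow T
  have hF : (Q ^ T * E * Q ^ T).PosSemidef := by
    have := hE.conjTranspose_mul_mul_same (Q ^ T)
    rwa [hQT] at this
  set F := Q ^ T * E * Q ^ T with hFdef
  rw [← hQ1']
  have h1 := hB.kronecker (posSemidef_gentle hQp hQ1 hE hE1 T)
  -- Two copies of (1 - B) ⊗ F replace 2(B ⊗ F) by 2(1 ⊗ F): the guarded term must not involve B,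
  -- which the distinguisher neither holds nor can run.
  have h2 := hB1.kronecker hF
  have h3 := ((h1.add h2).add h2).trace_mul_nonneg hτ
  have e : B ⊗ₖ ((2 : ℝ) • (Q ^ T * E * Q ^ T) + (2 * T : ℝ) • (1 - Q) - E) + (1 - B) ⊗ₖ F +
      (1 - B) ⊗ₖ F = (2 : ℝ) • ((1 : Matrix β β ℂ) ⊗ₖ F) +
        (2 * T : ℝ) • (B ⊗ₖ (1 - Q)) - B ⊗ₖ E := by
    ext u v
    simp only [← hFdef, Matrix.add_apply, Matrix.sub_apply, kroneckerMap_apply,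
      Matrix.smul_apply, Complex.real_smul]
    push_cast
    ring
  rw [e] at h3
  simp only [Matrix.sub_mul, Matrix.add_mul, Matrix.smul_mul, Matrix.trace_sub,
    Matrix.trace_add, Matrix.trace_smul, Complex.sub_re, Complex.add_re, Complex.real_smul,
    Complex.re_ofReal_mul] at h3
  linarith

/-- The guarded test rarely accepts the replaced register. -/
theorem trace_guarded_replaceState_le {E : Matrix (γ × α) (γ × α) ℂ} (hE : E.PosSemidef)
    (hE1 : (1 - E).PosSemidef) {τ : Matrix (β × (γ × α)) (β × (γ × α)) ℂ}
    (hτ : τ.PosSemidef) (ψ : δ → γ → ℂ) (hψ : ∑ d, ∑ z, star (ψ d z) * ψ d z = 1) (T : ℕ) :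
    (((1 : Matrix β β ℂ) ⊗ₖ
        ((1 - (1 : Matrix γ γ ℂ) ⊗ₖ averageEffect ψ E) ^ T * E *
          (1 - (1 : Matrix γ γ ℂ) ⊗ₖ averageEffect ψ E) ^ T)) * replaceState τ ψ).trace.re ≤
      1 / (2 * T + 1) * τ.trace.re := by
  rw [trace_mul_replaceState]
  set P := averageEffect ψ E with hP
  have hPp : P.PosSemidef := averageEffect_posSemidef ψ hE
  have hP1 : (1 - P).PosSemidef := by
    rw [hP, ← averageEffect_one (α := α) ψ hψ, ← averageEffect_sub]
    exact averageEffect_posSemidef ψ hE1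
  have hQ' : 1 - (1 : Matrix γ γ ℂ) ⊗ₖ P = (1 : Matrix γ γ ℂ) ⊗ₖ (1 - P) := by
    rw [kronecker_sub', Matrix.one_kronecker_one]
  -- The averaged guarded test is a polynomial in P alone, so a scalar bound at x = 1 - P suffices.
  rw [hQ', one_kronecker_pow, averageEffect_conj ψ E (K := (1 - P) ^ T) (hP1.1.pow T), ← hP]
  have hPe : P = 1 - (1 - P) := by abel
  have hp := posSemidef_smul_one_sub_pow hP1 (by rw [← hPe]; exact hPp) T
  rw [← hPe] at hp
  have h := (Matrix.PosSemidef.one (n := β) (R := ℂ)).kronecker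
    ((Matrix.PosSemidef.one (n := γ) (R := ℂ)).kronecker hp)
  have h2 := trace_mul_re_mono (X := (1 : Matrix β β ℂ) ⊗ₖ
    ((1 : Matrix γ γ ℂ) ⊗ₖ ((1 - P) ^ T * P * (1 - P) ^ T)))
    (X' := (1 / (2 * T + 1) : ℝ) • (1 : Matrix (β × (γ × α)) (β × (γ × α)) ℂ)) (by
      rwa [kronecker_sub', kronecker_sub', Matrix.kronecker_smul, Matrix.kronecker_smul,
        Matrix.one_kronecker_one, Matrix.one_kronecker_one] at h) hτ
  refine h2.trans_eq ?_
  rw [Matrix.smul_mul, Matrix.one_mul, Matrix.trace_smul, Complex.real_smul,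
    Complex.re_ofReal_mul]

end LinearAlgebra

/-! ### Circuit unitaries: embedding into more wires, inverses, unitarity. -/

section Circuits

variable {V R W : Type} [Fintype V] [DecidableEq V] [Fintype R] [DecidableEq R]
  [Fintype W] [DecidableEq W]

/-- Splitting the bits of a register along a partition of its wires. -/
def splitBits {V R W : Type} (e : V ⊕ R ≃ W) : Bits W ≃ Bits V × Bits R where
  toFun w := (w ∘ e ∘ Sum.inl, w ∘ e ∘ Sum.inr)
  invFun p := Sum.elim p.1 p.2 ∘ e.symm
  left_inv w := by
    funext x
    obtain ⟨y, rfl⟩ := e.surjective x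
    rcases y with y | y <;> simp
  right_inv p := by
    ext x <;> simp

/-- The operator `M ⊗ 1` on the wires `W ≃ V ⊕ R`. -/
def liftWires (e : V ⊕ R ≃ W) (M : Matrix (Bits V) (Bits V) ℂ) :
    Matrix (Bits W) (Bits W) ℂ :=
  Matrix.of fun w w' =>
    if w ∘ e ∘ Sum.inr = w' ∘ e ∘ Sum.inr then M (w ∘ e ∘ Sum.inl) (w' ∘ e ∘ Sum.inl) else 0

theorem liftWires_one (e : V ⊕ R ≃ W) : liftWires e 1 = 1 := by
  ext w w'
  have h := (splitBits e).injective.eq_iff (a := w) (b := w')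
  simp only [splitBits, Equiv.coe_fn_mk, Prod.mk.injEq] at h
  by_cases h1 : w ∘ e ∘ Sum.inr = w' ∘ e ∘ Sum.inr <;>
    simp [liftWires, Matrix.one_apply, ← h, h1]

theorem liftWires_mul (e : V ⊕ R ≃ W) (M N : Matrix (Bits V) (Bits V) ℂ) :
    liftWires e (M * N) = liftWires e M * liftWires e N := by
  ext w w'
  rw [Matrix.mul_apply, ← (splitBits e).symm.sum_comp, Fintype.sum_prod_type]
  have h1 : ∀ (x : Bits V) (y : Bits R), (Sum.elim x y ∘ e.symm) ∘ e ∘ Sum.inl = x := by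
    intro x y; funext z; simp
  have h2 : ∀ (x : Bits V) (y : Bits R), (Sum.elim x y ∘ e.symm) ∘ e ∘ Sum.inr = y := by
    intro x y; funext z; simp
  simp only [liftWires, of_apply, splitBits, Equiv.coe_fn_symm_mk, h1, h2, ite_mul, zero_mul,
    mul_ite, mul_zero, Finset.sum_ite_eq, Finset.mem_univ, if_true]
  split_ifs with h <;> simp [Matrix.mul_apply, h]

theorem liftWires_conjTranspose (e : V ⊕ R ≃ W) (M : Matrix (Bits V) (Bits V) ℂ) :
    (liftWires e M)ᴴ = liftWires e Mᴴ := by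
  ext w w'
  simp only [liftWires, conjTranspose_apply, of_apply, eq_comm (a := w' ∘ e ∘ Sum.inr)]
  split_ifs <;> simp

/-- The matrix of a map on basis states. -/
def basisMap (F : Bits V → Bits W) : Matrix (Bits W) (Bits V) ℂ :=
  Matrix.of fun u v => if u = F v then 1 else 0

theorem basisMap_mul (F : Bits W → Bits W) (G : Bits W → Bits W) :
    basisMap F * basisMap G = basisMap (F ∘ G) := by
  ext u v
  simp [basisMap, Matrix.mul_apply]

theorem basisMap_id : basisMap (id : Bits W → Bits W) = 1 := by
  ext u v
  simp [basisMap, Matrix.one_apply]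

theorem basisMap_conjTranspose {F : Bits W → Bits W} (hF : Function.Involutive F) :
    (basisMap F)ᴴ = basisMap F := by
  ext u v
  have : v = F u ↔ u = F v := ⟨fun h => by rw [h, hF], fun h => by rw [h, hF]⟩
  simp only [basisMap, conjTranspose_apply, of_apply, this]
  split_ifs <;> simp

theorem liftWires_basisMap (e : V ⊕ R ≃ W) (F : Bits V → Bits V) :
    liftWires e (basisMap F) =
      basisMap fun w => (splitBits e).symm (F (w ∘ e ∘ Sum.inl), w ∘ e ∘ Sum.inr) := by
  ext w w'
  have h : w = (splitBits e).symm (F (w' ∘ e ∘ Sum.inl), w' ∘ e ∘ Sum.inr) ↔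
      w ∘ e ∘ Sum.inr = w' ∘ e ∘ Sum.inr ∧ w ∘ e ∘ Sum.inl = F (w' ∘ e ∘ Sum.inl) := by
    rw [Equiv.eq_symm_apply, splitBits, Equiv.coe_fn_mk, Prod.mk.injEq, and_comm]
  simp only [liftWires, basisMap, of_apply, h, ite_and]

namespace QGate

/-- Rename the wires of a gate. -/
def map {V W : Type} (f : V ↪ W) : QGate V → QGate W
  | .one i U => .one (f i) U
  | .cnot i j h => .cnot (f i) (f j) (f.injective.ne h)
  | .toffoli i j k h1 h2 h3 =>
    .toffoli (f i) (f j) (f k) (f.injective.ne h1) (f.injective.ne h2) (f.injective.ne h3)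

/-- The inverse of a gate. -/
def inv {W : Type} : QGate W → QGate W
  | .one i U => .one i (star U)
  | .cnot i j h => .cnot i j h
  | .toffoli i j k h1 h2 h3 => .toffoli i j k h1 h2 h3

theorem matrix_cnot (i j : W) (h : i ≠ j) :
    (QGate.cnot i j h).matrix = basisMap fun v => Function.update v j (xor (v j) (v i)) := rfl

theorem matrix_toffoli (i j k : W) (h1 : i ≠ j) (h2 : i ≠ k) (h3 : j ≠ k) :
    (QGate.toffoli i j k h1 h2 h3).matrix =
      basisMap fun v => Function.update v k (xor (v k) (v i && v j)) := rfl

/-- The inclusion of the first part of a partition of the wires. -/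
def _root_.wireEmbedding {V R W : Type} (e : V ⊕ R ≃ W) : V ↪ W :=
  ⟨e ∘ Sum.inl, e.injective.comp Sum.inl_injective⟩

theorem _root_.splitBits_symm_update (e : V ⊕ R ≃ W) (w : Bits W) (j : V) (b : Bool) :
    (splitBits e).symm (Function.update (w ∘ e ∘ Sum.inl) j b, w ∘ e ∘ Sum.inr) =
      Function.update w (e (Sum.inl j)) b := by
  funext x
  obtain ⟨y, rfl⟩ := e.surjective x
  rcases y with y | y
  · simp only [splitBits, Equiv.coe_fn_symm_mk, Function.comp_apply, Equiv.symm_apply_apply,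
      Sum.elim_inl, Function.update_apply, EmbeddingLike.apply_eq_iff_eq, Sum.inl.injEq]
  · simp only [splitBits, Equiv.coe_fn_symm_mk, Function.comp_apply, Equiv.symm_apply_apply,
      Sum.elim_inr, Function.update_apply, EmbeddingLike.apply_eq_iff_eq, reduceCtorEq, if_false]

theorem matrix_map (e : V ⊕ R ≃ W) (g : QGate V) :
    (g.map (wireEmbedding e)).matrix = liftWires e g.matrix := by
  cases g with
  | one i U =>
    ext w w'
    have h : (∀ j, j ≠ e (Sum.inl i) → w j = w' j) ↔
        w ∘ e ∘ Sum.inr = w' ∘ e ∘ Sum.inr ∧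
          ∀ j, j ≠ i → (w ∘ e ∘ Sum.inl) j = (w' ∘ e ∘ Sum.inl) j := by
      constructor
      · intro h
        exact ⟨funext fun x => h _ (by simp), fun j hj => h _ (by simpa using hj)⟩
      · rintro ⟨h1, h2⟩ x hx
        obtain ⟨y, rfl⟩ := e.surjective x
        rcases y with y | y
        · exact h2 y (by simpa using hx)
        · exact congrFun h1 y
    simp only [map, matrix, liftWires, of_apply, wireEmbedding, Function.Embedding.coeFn_mk,
      Function.comp_apply, h, ite_and] at h ⊢
  | cnot i j hij =>
    rw [map, matrix_cnot, matrix_cnot, liftWires_basisMap]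
    simp_rw [splitBits_symm_update]
    rfl
  | toffoli i j k h1 h2 h3 =>
    rw [map, matrix_toffoli, matrix_toffoli, liftWires_basisMap]
    simp_rw [splitBits_symm_update]
    rfl

theorem matrix_inv (g : QGate W) : g.inv.matrix = g.matrixᴴ := by
  cases g with
  | one i U =>
    ext u v
    have h : (∀ j, j ≠ i → v j = u j) ↔ ∀ j, j ≠ i → u j = v j := by simp only [eq_comm]
    simp only [inv, matrix, of_apply, conjTranspose_apply, h, Unitary.coe_star, star_apply]
    split_ifs <;> simp
  | cnot i j hij =>
    rw [inv, matrix_cnot, basisMap_conjTranspose]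
    intro v
    simp [hij, Function.update_idem]
  | toffoli i j k h1 h2 h3 =>
    rw [inv, matrix_toffoli, basisMap_conjTranspose]
    intro v
    simp [h2, h3, Function.update_idem]

theorem conjTranspose_mul_matrix (g : QGate W) : g.matrixᴴ * g.matrix = 1 := by
  cases g with
  | one i U =>
    -- Viewed on the single wire `i`, the gate is `U` itself, so unitarity is inherited through
    -- `liftWires`.
    have e : (QGate.one i U).matrix = liftWires (Equiv.sumCompl (· = i))
        ((U : Matrix Bool Bool ℂ).submatrix (Equiv.funUnique _ _) (Equiv.funUnique _ _)) := by
      ext u v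
      have h : (∀ j, j ≠ i → u j = v j) ↔ u ∘ Equiv.sumCompl (· = i) ∘ Sum.inr =
          v ∘ Equiv.sumCompl (· = i) ∘ Sum.inr := by
        constructor
        · intro h; funext x; exact h _ x.2
        · intro h j hj; exact congrFun h ⟨j, hj⟩
      simp only [matrix, liftWires, of_apply, h, submatrix_apply]
      rfl
    rw [e, liftWires_conjTranspose, ← liftWires_mul, conjTranspose_submatrix,
      submatrix_mul_equiv, ← star_eq_conjTranspose, Unitary.coe_star_mul_self,
      submatrix_one_equiv, liftWires_one]
  | cnot i j hij =>
    rw [← matrix_inv, inv, matrix_cnot, basisMap_mul, ← basisMap_id]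
    congr 1
    funext v
    simp [hij, Function.update_idem]
  | toffoli i j k h1 h2 h3 =>
    rw [← matrix_inv, inv, matrix_toffoli, basisMap_mul, ← basisMap_id]
    congr 1
    funext v
    simp [h2, h3, Function.update_idem]

/-- The gate flipping one wire. -/
def flip {W : Type} (i : W) : QGate W :=
  .one i ⟨Matrix.of fun x y => if x = !y then 1 else 0, by
    rw [Matrix.mem_unitaryGroup_iff]
    ext x y
    cases x <;> cases y <;> simp [Matrix.mul_apply, star_apply]⟩

theorem matrix_flip (i : W) :
    (flip i).matrix = basisMap fun v => Function.update v i (!v i) := by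
  ext u v
  have h : u = Function.update v i (!v i) ↔ (∀ j, j ≠ i → u j = v j) ∧ u i = !v i := by
    rw [Function.eq_update_iff]; tauto
  simp only [flip, matrix, basisMap, of_apply, h, ite_and]

end QGate

theorem foldl_circuit (gs : List (QGate W)) (M : Matrix (Bits W) (Bits W) ℂ) :
    gs.foldl (fun U g => g.matrix * U) M = circuitUnitary gs * M := by
  induction gs generalizing M with
  | nil => simp [circuitUnitary]
  | cons g gs ih =>
    simp only [circuitUnitary, List.foldl_cons, Matrix.mul_one] at ih ⊢
    rw [ih, ih g.matrix, Matrix.mul_assoc]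

theorem circuitUnitary_nil : circuitUnitary ([] : List (QGate W)) = 1 := rfl

theorem circuitUnitary_append (gs hs : List (QGate W)) :
    circuitUnitary (gs ++ hs) = circuitUnitary hs * circuitUnitary gs := by
  rw [circuitUnitary, List.foldl_append, foldl_circuit]
  rfl

theorem circuitUnitary_singleton (g : QGate W) : circuitUnitary [g] = g.matrix := by
  simp [circuitUnitary]

theorem circuitUnitary_cons (g : QGate W) (gs : List (QGate W)) :
    circuitUnitary (g :: gs) = circuitUnitary gs * g.matrix := by
  rw [← List.singleton_append, circuitUnitary_append, circuitUnitary_singleton]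

theorem circuitUnitary_map (e : V ⊕ R ≃ W) (gs : List (QGate V)) :
    circuitUnitary (gs.map (QGate.map (wireEmbedding e))) = liftWires e (circuitUnitary gs) := by
  induction gs with
  | nil => exact (liftWires_one e).symm
  | cons g gs ih =>
    rw [List.map_cons, circuitUnitary_cons, circuitUnitary_cons, ih, QGate.matrix_map,
      liftWires_mul]

theorem circuitUnitary_inv (gs : List (QGate W)) :
    circuitUnitary (gs.map QGate.inv).reverse = (circuitUnitary gs)ᴴ := by
  induction gs with
  | nil => simp [circuitUnitary_nil]
  | cons g gs ih =>
    rw [List.map_cons, List.reverse_cons, circuitUnitary_append, circuitUnitary_singleton,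
      circuitUnitary_cons, ih, conjTranspose_mul, QGate.matrix_inv]

theorem circuitUnitary_conjTranspose_mul (gs : List (QGate W)) :
    (circuitUnitary gs)ᴴ * circuitUnitary gs = 1 := by
  induction gs with
  | nil => simp [circuitUnitary_nil]
  | cons g gs ih =>
    rw [circuitUnitary_cons, conjTranspose_mul, Matrix.mul_assoc,
      ← Matrix.mul_assoc (circuitUnitary gs)ᴴ, ih, Matrix.one_mul,
      QGate.conjTranspose_mul_matrix]

end Circuits

/-! ### Calculus of operators given by circuits with zero ancillas and zero projections. -/

section Realizable

/-- All bits zero. -/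
def zeroBits (Z : Type) : Bits Z := fun _ => false

/-- Bits of the wires `W ≃ I ⊕ Z`, equal to `i` on `I` and zero on `Z`. -/
def padBits {I Z W : Type} (e : I ⊕ Z ≃ W) (i : Bits I) : Bits W :=
  Sum.elim i (zeroBits Z) ∘ e.symm

theorem padBits_inl {I Z W : Type} (e : I ⊕ Z ≃ W) (i : Bits I) (x : I) :
    padBits e i (e (Sum.inl x)) = i x := by simp [padBits]

theorem padBits_injective {I Z W : Type} (e : I ⊕ Z ≃ W) :
    Function.Injective (padBits e) := fun i i' h => by
  funext x
  rw [← padBits_inl e i x, h, padBits_inl]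

/-- The operator `A` is obtained by adjoining zero ancillas, applying gates, and projecting some
wires onto zero; `s` bounds the number of wires plus gates. -/
def Realizable {I O : Type} (A : Matrix (Bits O) (Bits I) ℂ) (s : ℕ) : Prop :=
  ∃ (W Z Z' : Type) (_ : Fintype W) (_ : DecidableEq W) (_ : Fintype Z) (_ : DecidableEq Z)
    (_ : Fintype Z') (_ : DecidableEq Z') (eI : I ⊕ Z ≃ W) (eO : O ⊕ Z' ≃ W)
    (gs : List (QGate W)), Fintype.card W + gs.length ≤ s ∧
      A = (circuitUnitary gs).submatrix (padBits eO) (padBits eI)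

variable {I O P X I' O' : Type} [Fintype I] [DecidableEq I] [Fintype O] [DecidableEq O]
  [Fintype P] [DecidableEq P] [Fintype X] [DecidableEq X]

theorem Realizable.mono {A : Matrix (Bits O) (Bits I) ℂ} {s t : ℕ} (h : Realizable A s)
    (hst : s ≤ t) : Realizable A t := by
  obtain ⟨W, Z, Z', _, _, _, _, _, _, eI, eO, gs, hs, hA⟩ := h
  exact ⟨W, Z, Z', inferInstance, inferInstance, inferInstance,
    inferInstance, inferInstance, inferInstance, eI, eO, gs, hs.trans hst, hA⟩

/-- Run the inverse gates backwards: zero initialisation and zero projection exchange roles. -/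
theorem Realizable.conjTranspose {A : Matrix (Bits O) (Bits I) ℂ} {s : ℕ}
    (h : Realizable A s) : Realizable Aᴴ s := by
  obtain ⟨W, Z, Z', _, _, _, _, _, _, eI, eO, gs, hs, rfl⟩ := h
  refine ⟨W, Z', Z, inferInstance, inferInstance, inferInstance,
    inferInstance, inferInstance, inferInstance, eO, eI, (gs.map QGate.inv).reverse, ?_, ?_⟩
  · simpa using hs
  · rw [circuitUnitary_inv, conjTranspose_submatrix]

theorem Realizable.reindex {A : Matrix (Bits O) (Bits I) ℂ} {s : ℕ}
    (h : Realizable A s) (eO : O ≃ O') (eI : I ≃ I') :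
    Realizable (A.submatrix (fun o : Bits O' => o ∘ eO) (fun i : Bits I' => i ∘ eI)) s := by
  obtain ⟨W, Z, Z', _, _, _, _, _, _, fI, fO, gs, hs, rfl⟩ := h
  refine ⟨W, Z, Z', inferInstance, inferInstance, inferInstance,
    inferInstance, inferInstance, inferInstance, (Equiv.sumCongr eI.symm (Equiv.refl _)).trans fI,
    (Equiv.sumCongr eO.symm (Equiv.refl _)).trans fO, gs, hs, ?_⟩
  rw [Matrix.submatrix_submatrix]
  congr 1
  · funext o x
    obtain ⟨y, rfl⟩ := fO.surjective x
    rcases y with y | y <;> simp [padBits]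
  · funext o x
    obtain ⟨y, rfl⟩ := fI.surjective x
    rcases y with y | y <;> simp [padBits]

theorem realizable_one : Realizable (1 : Matrix (Bits I) (Bits I) ℂ) (Fintype.card I) := by
  refine ⟨I, Empty, Empty, inferInstance, inferInstance, inferInstance, inferInstance,
    inferInstance, inferInstance, Equiv.sumEmpty _ _, Equiv.sumEmpty _ _, [], by simp, ?_⟩
  rw [circuitUnitary_nil, Matrix.submatrix_one _ (padBits_injective _)]

/-- The operator `A ⊗ 1`. -/
def tensorOne (X : Type) [Fintype X] (A : Matrix (Bits O) (Bits I) ℂ) :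
    Matrix (Bits (O ⊕ X)) (Bits (I ⊕ X)) ℂ :=
  Matrix.of fun o i =>
    if o ∘ Sum.inr = i ∘ Sum.inr then A (o ∘ Sum.inl) (i ∘ Sum.inl) else 0

/-- Adding spectator wires to a padded register. -/
def padEquiv {I Z W : Type} (X : Type) (e : I ⊕ Z ≃ W) : (I ⊕ X) ⊕ Z ≃ W ⊕ X :=
  (Equiv.sumAssoc I X Z).trans ((Equiv.sumCongr (Equiv.refl _) (Equiv.sumComm X Z)).trans
    ((Equiv.sumAssoc I Z X).symm.trans (Equiv.sumCongr e (Equiv.refl _))))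

theorem padBits_padEquiv_inl {I Z W X : Type} (e : I ⊕ Z ≃ W) (i : Bits (I ⊕ X)) :
    padBits (padEquiv X e) i ∘ (Equiv.refl (W ⊕ X)) ∘ Sum.inl = padBits e (i ∘ Sum.inl) := by
  funext x
  obtain ⟨y, rfl⟩ := e.surjective x
  rcases y with y | y <;> simp [padBits, padEquiv]

theorem padBits_padEquiv_inr {I Z W X : Type} (e : I ⊕ Z ≃ W) (i : Bits (I ⊕ X)) :
    padBits (padEquiv X e) i ∘ (Equiv.refl (W ⊕ X)) ∘ Sum.inr = i ∘ Sum.inr := by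
  funext x
  simp [padBits, padEquiv]

theorem Realizable.tensor_one {A : Matrix (Bits O) (Bits I) ℂ} {s : ℕ}
    (h : Realizable A s) : Realizable (tensorOne X A) (s + Fintype.card X) := by
  obtain ⟨W, Z, Z', _, _, _, _, _, _, eI, eO, gs, hs, rfl⟩ := h
  refine ⟨W ⊕ X, Z, Z', inferInstance, inferInstance, inferInstance,
    inferInstance, inferInstance, inferInstance,
    padEquiv X eI, padEquiv X eO,
    gs.map (QGate.map (wireEmbedding (Equiv.refl (W ⊕ X)))), ?_, ?_⟩
  · simp only [Fintype.card_sum, List.length_map]; omega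
  · rw [circuitUnitary_map]
    ext o i
    simp only [tensorOne, of_apply, submatrix_apply, liftWires, padBits_padEquiv_inl,
      padBits_padEquiv_inr]

/-- The second circuit gets its own fresh ancillas and never touches the wires projected by the
first, so all projections can be deferred to the end. Only the new wires are added, hence the
additive cost. -/
theorem Realizable.mul {A : Matrix (Bits O) (Bits I) ℂ} {B : Matrix (Bits P) (Bits O) ℂ}
    {s t : ℕ} (hB : Realizable B t) (hA : Realizable A s) : Realizable (B * A) (t + s) := by
  obtain ⟨W₁, Z₁, Z₁', _, _, _, _, _, _, eI₁, eO₁, gs₁, hs₁, rfl⟩ := hA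
  obtain ⟨W₂, Z₂, Z₂', _, _, _, _, _, _, eI₂, eO₂, gs₂, hs₂, rfl⟩ := hB
  let mid : O ⊕ (Z₁' ⊕ Z₂) ≃ W₁ ⊕ Z₂ :=
    (Equiv.sumAssoc _ _ _).symm.trans (Equiv.sumCongr eO₁ (Equiv.refl _))
  let e₂ : W₂ ⊕ Z₁' ≃ W₁ ⊕ Z₂ :=
    ((Equiv.sumCongr eI₂.symm (Equiv.refl _)).trans (Equiv.sumAssoc _ _ _)).trans
      ((Equiv.sumCongr (Equiv.refl _) (Equiv.sumComm _ _)).trans mid)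
  let eI : I ⊕ (Z₁ ⊕ Z₂) ≃ W₁ ⊕ Z₂ :=
    (Equiv.sumAssoc _ _ _).symm.trans (Equiv.sumCongr eI₁ (Equiv.refl _))
  let eO : P ⊕ (Z₂' ⊕ Z₁') ≃ W₁ ⊕ Z₂ :=
    ((Equiv.sumAssoc _ _ _).symm.trans (Equiv.sumCongr eO₂ (Equiv.refl _))).trans e₂
  refine ⟨W₁ ⊕ Z₂, Z₁ ⊕ Z₂, Z₂' ⊕ Z₁', inferInstance, inferInstance, inferInstance,
    inferInstance, inferInstance, inferInstance, eI, eO,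
    gs₁.map (QGate.map (wireEmbedding (Equiv.refl _))) ++
      gs₂.map (QGate.map (wireEmbedding e₂)), ?_, ?_⟩
  · have h : Fintype.card Z₂ ≤ Fintype.card W₂ := by
      rw [← Fintype.card_congr eI₂, Fintype.card_sum]; omega
    simp only [Fintype.card_sum, List.length_append, List.length_map]
    omega
  · rw [circuitUnitary_append, circuitUnitary_map, circuitUnitary_map]
    ext p i
    rw [submatrix_apply, Matrix.mul_apply, Matrix.mul_apply, ← (splitBits mid).symm.sum_comp,
      Fintype.sum_prod_type]
    refine Finset.sum_congr rfl fun o _ => ?_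
    -- Among the intermediate basis states only those vanishing on `Z₁'` and `Z₂` contribute: the
    -- second circuit leaves `Z₁'` alone before its projection, and the first leaves `Z₂` at its
    -- initial zero.
    rw [Fintype.sum_eq_single (zeroBits _)]
    · have h1 : padBits eO p ∘ e₂ ∘ Sum.inl = padBits eO₂ p := by
        funext x
        obtain ⟨y, rfl⟩ := eO₂.surjective x
        rcases y with y | y <;> simp [padBits, eO, zeroBits]
      have h2 : padBits eO p ∘ e₂ ∘ Sum.inr = zeroBits _ := by
        funext x
        simp [padBits, eO, zeroBits]
      have h3 : (splitBits mid).symm (o, zeroBits _) ∘ e₂ ∘ Sum.inl = padBits eI₂ o := by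
        funext x
        obtain ⟨y, rfl⟩ := eI₂.surjective x
        rcases y with y | y <;> simp [padBits, e₂, splitBits, zeroBits]
      have h4 : (splitBits mid).symm (o, zeroBits _) ∘ e₂ ∘ Sum.inr = zeroBits _ := by
        funext x
        simp [e₂, splitBits, zeroBits]
      have h5 : padBits eI i ∘ (Equiv.refl (W₁ ⊕ Z₂)) ∘ Sum.inl = padBits eI₁ i := by
        funext x
        obtain ⟨y, rfl⟩ := eI₁.surjective x
        rcases y with y | y <;> simp [padBits, eI, zeroBits]
      have h6 : padBits eI i ∘ (Equiv.refl (W₁ ⊕ Z₂)) ∘ Sum.inr = zeroBits _ := by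
        funext x
        simp [padBits, eI, zeroBits]
      have h7 : (splitBits mid).symm (o, zeroBits _) ∘ (Equiv.refl (W₁ ⊕ Z₂)) ∘ Sum.inl =
          padBits eO₁ o := by
        funext x
        obtain ⟨y, rfl⟩ := eO₁.surjective x
        rcases y with y | y <;> simp [padBits, mid, splitBits, zeroBits]
      have h8 : (splitBits mid).symm (o, zeroBits _) ∘ (Equiv.refl (W₁ ⊕ Z₂)) ∘ Sum.inr =
          zeroBits _ := by
        funext x
        simp [mid, splitBits, zeroBits]
      simp only [liftWires, of_apply, h1, h2, h3, h4, h5, h6, h7, h8, if_true, submatrix_apply]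
    · intro z hz
      by_contra hne
      apply hz
      have ha := left_ne_zero_of_mul hne
      have hb := right_ne_zero_of_mul hne
      simp only [liftWires, of_apply, ne_eq, ite_eq_right_iff, not_forall] at ha hb
      obtain ⟨ha, -⟩ := ha
      obtain ⟨hb, -⟩ := hb
      funext x
      rcases x with x | x
      · have := congrFun ha x
        simp [padBits, eO, zeroBits, e₂, splitBits] at this
        simp [zeroBits, this]
      · have := congrFun hb x
        simp [padBits, eI, zeroBits, mid, splitBits] at this
        simp [zeroBits, this]

theorem Realizable.pow {A : Matrix (Bits I) (Bits I) ℂ} {s : ℕ} (hA : Realizable A s) (T : ℕ) :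
    Realizable (A ^ T) (T * s + Fintype.card I) := by
  induction T with
  | zero => simpa using realizable_one
  | succ T ih =>
    rw [pow_succ']
    exact (hA.mul ih).mono (by rw [Nat.add_mul]; omega)

end Realizable

/-! ### Circuits as isometries, and the operators of their two outcomes. -/

namespace QAlg

variable {I O : Type} [Fintype I] [DecidableEq I] [Fintype O] [DecidableEq O]

/-- The isometry of a circuit before tracing out the discarded wires. -/
def isometry (M : QAlg I O) : Matrix (Bits (O ⊕ Fin M.disc)) (Bits I) ℂ :=
  Matrix.of fun o i => M.kraus (o ∘ Sum.inr) (o ∘ Sum.inl) i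

theorem isometry_eq (M : QAlg I O) : M.isometry = (circuitUnitary M.gates).submatrix
    (fun o => o ∘ M.out.symm) (padBits (Equiv.refl _)) := by
  ext o i
  simp only [isometry, kraus, of_apply, submatrix_apply, padBits, Sum.elim_comp_inl_inr]
  rfl

theorem realizable_isometry (M : QAlg I O) : Realizable M.isometry M.size := by
  refine ⟨I ⊕ Fin M.anc, Fin M.anc, Empty, inferInstance, inferInstance, inferInstance,
    inferInstance, inferInstance, inferInstance, Equiv.refl _,
    (Equiv.sumEmpty _ _).trans M.out, M.gates, by simp [size], ?_⟩
  rw [isometry_eq]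
  congr 1

theorem isometry_conjTranspose_mul (M : QAlg I O) : M.isometryᴴ * M.isometry = 1 := by
  rw [isometry_eq, conjTranspose_submatrix]
  have h := Matrix.submatrix_mul_equiv (circuitUnitary M.gates)ᴴ (circuitUnitary M.gates)
    (padBits (Equiv.refl _) : Bits I → _) (Equiv.arrowCongr M.out (Equiv.refl Bool))
    (padBits (Equiv.refl _) : Bits I → _)
  rw [circuitUnitary_conjTranspose_mul, submatrix_one _ (padBits_injective _)] at h
  exact h

theorem sum_kraus_conjTranspose_mul (M : QAlg I O) : ∑ d, (M.kraus d)ᴴ * M.kraus d = 1 := by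
  rw [← M.isometry_conjTranspose_mul]
  ext i i'
  simp only [Matrix.sum_apply, Matrix.mul_apply, conjTranspose_apply]
  rw [← (Equiv.sumArrowEquivProdArrow _ _ _).symm.sum_comp, Fintype.sum_prod_type,
    Finset.sum_comm]
  rfl

/-- The operator of a circuit with one output qubit belonging to the outcome `b`. -/
def outcomeOp (M : QAlg I Unit) (b : Bool) : Matrix (Bits (Fin M.disc)) (Bits I) ℂ :=
  Matrix.of fun d i => M.kraus d (fun _ => b) i

theorem accept_eq (M : QAlg I Unit) : M.accept = (M.outcomeOp true)ᴴ * M.outcomeOp true := by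
  ext i i'
  simp [accept, outcomeOp, Matrix.sum_apply, Matrix.mul_apply, Matrix.single_apply, ite_and]

/-- The form K†K makes the complementary effect itself implementable as an operator: run the
circuit, project onto rejection, run it backwards. -/
theorem one_sub_accept_eq (M : QAlg I Unit) :
    1 - M.accept = (M.outcomeOp false)ᴴ * M.outcomeOp false := by
  rw [accept_eq, sub_eq_iff_eq_add, ← sum_kraus_conjTranspose_mul M]
  ext i i'
  simp only [Matrix.sum_apply, Matrix.add_apply, Matrix.mul_apply, conjTranspose_apply,
    outcomeOp, of_apply, ← Finset.sum_add_distrib]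
  refine Finset.sum_congr rfl fun d _ => ?_
  rw [← (Equiv.funUnique Unit Bool).symm.sum_comp, Fintype.sum_bool, add_comm]
  rfl

theorem accept_posSemidef (M : QAlg I Unit) : M.accept.PosSemidef := by
  rw [accept_eq]
  exact posSemidef_conjTranspose_mul_self _

theorem one_sub_accept_posSemidef (M : QAlg I Unit) : (1 - M.accept).PosSemidef := by
  rw [one_sub_accept_eq]
  exact posSemidef_conjTranspose_mul_self _

theorem realizable_outcomeOp_false (M : QAlg I Unit) :
    Realizable (M.outcomeOp false) M.size := by
  refine ⟨I ⊕ Fin M.anc, Fin M.anc, Unit, inferInstance, inferInstance, inferInstance,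
    inferInstance, inferInstance, inferInstance, Equiv.refl _,
    (Equiv.sumComm _ _).trans M.out, M.gates, by simp [size], ?_⟩
  ext d i
  simp only [outcomeOp, kraus, of_apply, submatrix_apply]
  congr 1
  funext x
  obtain ⟨y, rfl⟩ := M.out.surjective x
  rcases y with y | y <;> simp [padBits, zeroBits]

/-- Projections are onto zero only, so the output wire is flipped first; this is the one extra gate.
-/
theorem realizable_outcomeOp_true (M : QAlg I Unit) :
    Realizable (M.outcomeOp true) (M.size + 1) := by
  refine ⟨I ⊕ Fin M.anc, Fin M.anc, Unit, inferInstance, inferInstance, inferInstance,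
    inferInstance, inferInstance, inferInstance, Equiv.refl _,
    (Equiv.sumComm _ _).trans M.out, M.gates ++ [QGate.flip (M.out (Sum.inl ()))],
    by simp [size]; omega, ?_⟩
  ext d i
  rw [circuitUnitary_append, circuitUnitary_singleton, QGate.matrix_flip, submatrix_apply,
    Matrix.mul_apply, Fintype.sum_eq_single (Sum.elim (fun _ => true) d ∘ M.out.symm)]
  · have : padBits ((Equiv.sumComm (Fin M.disc) Unit).trans M.out) d =
        Function.update (Sum.elim (fun _ => true) d ∘ M.out.symm) (M.out (Sum.inl ()))
          (!(Sum.elim (fun _ => true) d ∘ M.out.symm) (M.out (Sum.inl ()))) := by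
      funext x
      obtain ⟨y, rfl⟩ := M.out.surjective x
      rcases y with y | y
      · simp [padBits, zeroBits]
      · rw [Function.update_of_ne (by simp)]
        simp [padBits]
    rw [basisMap, of_apply, if_pos this, one_mul]
    rfl
  · intro w hw
    rw [basisMap, of_apply, if_neg, zero_mul]
    intro h
    apply hw
    funext x
    have hx := congrFun h x
    obtain ⟨y, rfl⟩ := M.out.surjective x
    rcases y with y | y
    · simpa [padBits, zeroBits] using hx
    · rw [Function.update_of_ne (by simp)] at hx
      simpa [padBits] using hx.symm

end QAlg

/-! ### From realizable operators back to one-bit tests. -/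

section Realization

variable {I O W Z X Y : Type} [Fintype I] [DecidableEq I] [Fintype O] [DecidableEq O]
  [Fintype W] [DecidableEq W] [Fintype Z] [DecidableEq Z] [Fintype X] [DecidableEq X]
  [Fintype Y] [DecidableEq Y]

/-- A circuit on arbitrary wires with a designated output wire `f`, as a `QAlg`. -/
theorem QAlg.exists_of_circuit (eI : I ⊕ Z ≃ W) (gs : List (QGate W)) (f : W) :
    ∃ M : QAlg I Unit, M.size = Fintype.card W + gs.length ∧ ∀ i i', M.accept i i' =
      ∑ v : Bits W, if v f = true then
        star (circuitUnitary gs v (padBits eI i)) * circuitUnitary gs v (padBits eI i')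
        else 0 := by
  let ew : I ⊕ Fin (Fintype.card Z) ≃ W :=
    (Equiv.sumCongr (Equiv.refl I) (Fintype.equivFin Z).symm).trans eI
  let f' := ew.symm f
  -- An empty complement lets `circuitUnitary_map` handle a pure renaming of wires.
  let e : W ⊕ Empty ≃ I ⊕ Fin (Fintype.card Z) := (Equiv.sumEmpty _ _).trans ew.symm
  let out : Unit ⊕ Fin (Fintype.card {x // ¬ x = f'}) ≃ I ⊕ Fin (Fintype.card Z) :=
    (Equiv.sumCongr (Equiv.ofUnique Unit {x // x = f'}) (Fintype.equivFin _).symm).trans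
      (Equiv.sumCompl (· = f'))
  refine ⟨⟨Fintype.card Z, Fintype.card {x // ¬ x = f'},
    gs.map (QGate.map (wireEmbedding e)), out⟩, ?_, fun i i' => ?_⟩
  · simp [QAlg.size, ← Fintype.card_congr eI]
  · rw [QAlg.accept_eq, Matrix.mul_apply, ← (splitBits (out.trans ew)).symm.sum_comp,
      Fintype.sum_prod_type, ← (Equiv.funUnique Unit Bool).symm.sum_comp, Fintype.sum_bool]
    have hf : out (Sum.inl ()) = f' := (Equiv.ofUnique Unit {x // x = f'} ()).2
    have h1 : ∀ b d, (splitBits (out.trans ew)).symm ((Equiv.funUnique Unit Bool).symm b, d) f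
        = b := by
      intro b d
      have : f = ew (out (Sum.inl ())) := by rw [hf]; simp [f']
      rw [this]
      simp [splitBits]
    simp only [h1, if_true, Bool.false_eq_true, if_false, Finset.sum_const_zero, add_zero]
    have h2 : ∀ d i, QAlg.outcomeOp ⟨Fintype.card Z, Fintype.card {x // ¬ x = f'},
        gs.map (QGate.map (wireEmbedding e)), out⟩ true d i = circuitUnitary gs
          ((splitBits (out.trans ew)).symm ((Equiv.funUnique Unit Bool).symm true, d))
          (padBits eI i) := by
      intro d i
      simp only [QAlg.outcomeOp, QAlg.kraus, of_apply]
      rw [circuitUnitary_map, liftWires, of_apply, if_pos (Subsingleton.elim _ _)]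
      congr 1
      funext x
      obtain ⟨y, rfl⟩ := eI.surjective x
      rcases y with y | y <;> simp [padBits, e, ew, zeroBits]
    simp only [conjTranspose_apply, h2]

/-- The running conjunction of the conditions that the wires `S i'`, `i' < i`, are zero, for
`i ≤ j`. -/
def zeroFlags {n : ℕ} (S : Fin n → W) (w : Bits W) (j : ℕ) : Bits (Fin (n + 1)) := fun i =>
  decide ((i : ℕ) ≤ j ∧ ∀ i' : Fin n, (i' : ℕ) < i → w (S i') = false)

theorem exists_zeroFlags_circuit {n : ℕ} (S : Fin n → W) (j : ℕ) (hj : j ≤ n) :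
    ∃ gs : List (QGate (W ⊕ Fin (n + 1))), gs.length = 3 * j + 1 ∧
      ∃ F, circuitUnitary gs = basisMap F ∧
        ∀ w, F (Sum.elim w (zeroBits _)) = Sum.elim w (zeroFlags S w j) := by
  induction j with
  | zero =>
    refine ⟨[QGate.flip (Sum.inr 0)], rfl, _,
      by rw [circuitUnitary_singleton, QGate.matrix_flip], fun w => ?_⟩
    funext x
    rcases x with x | x
    · rw [Function.update_of_ne (by simp)]; rfl
    · by_cases hx : x = 0
      · subst hx; simp [zeroBits, zeroFlags]
      · rw [Function.update_of_ne (by simpa using hx)]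
        simp [zeroBits, zeroFlags, hx]
  | succ j ih =>
    obtain ⟨gs, hl, F, hF, hFw⟩ := ih (by omega)
    let k : Fin n := ⟨j, by omega⟩
    -- The Toffoli gate computes the AND of the previous flag and the negated wire into a flag still
    -- equal to zero; the second flip restores the wire. Three gates per wire, plus one setting flag
    -- 0 to true.
    refine ⟨gs ++ [QGate.flip (Sum.inl (S k)),
      QGate.toffoli (Sum.inl (S k)) (Sum.inr k.castSucc) (Sum.inr k.succ) (by simp) (by simp)
        (by simp [Fin.ext_iff]), QGate.flip (Sum.inl (S k))], by simp [hl]; ring, ?_⟩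
    rw [circuitUnitary_append, hF, circuitUnitary_cons, circuitUnitary_cons,
      circuitUnitary_singleton, QGate.matrix_flip, QGate.matrix_toffoli, basisMap_mul,
      basisMap_mul, basisMap_mul]
    refine ⟨_, rfl, ?_⟩
    intro w
    rw [Function.comp_apply, hFw]
    simp only [Function.comp_apply, Sum.update_elim_inl, Sum.update_elim_inr, Sum.elim_inl,
      Sum.elim_inr, Function.update_self, Function.update_idem, Bool.not_not,
      Function.update_eq_self]
    congr 1
    funext x
    by_cases hx : x = k.succ
    · subst hx
      rw [Function.update_self, Bool.eq_iff_iff]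
      have h0 : zeroFlags S w j k.succ = false := by simp [zeroFlags, k]
      rw [h0, Bool.false_xor, Bool.and_eq_true, Bool.not_eq_true']
      simp only [zeroFlags, decide_eq_true_eq, Fin.val_succ, Fin.val_castSucc, k, le_refl,
        true_and]
      constructor
      · rintro ⟨h1, h2⟩ i' hi'
        rcases Nat.lt_succ_iff_lt_or_eq.mp hi' with h | h
        · exact h2 i' h
        · have : i' = ⟨j, by omega⟩ := Fin.ext h
          rw [this]; exact h1
      · intro h
        exact ⟨h _ (Nat.lt_succ_self j), fun i' hi' => h i' (by omega)⟩
    · rw [Function.update_of_ne hx]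
      have hx' : (x : ℕ) ≠ j + 1 := fun h => hx (Fin.ext (by simp [h, k]))
      have : (x : ℕ) ≤ j ↔ (x : ℕ) ≤ j + 1 := by omega
      simp only [zeroFlags, this]

/-- A†A is the effect of the event that every projected wire ends at zero. Instead of projecting,
the circuit computes this event into the last flag and outputs it. -/
theorem Realizable.exists_qalg {A : Matrix (Bits O) (Bits I) ℂ} {s : ℕ} (h : Realizable A s) :
    ∃ M : QAlg I Unit, M.accept = Aᴴ * A ∧ M.size ≤ 5 * s + 2 := by
  obtain ⟨W, Z, Z', _, _, _, _, _, _, eI, eO, gs, hs, rfl⟩ := h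
  let n := Fintype.card Z'
  have hn : n ≤ Fintype.card W := by
    rw [← Fintype.card_congr eO, Fintype.card_sum]; omega
  let S : Fin n → W := fun j => eO (Sum.inr ((Fintype.equivFin Z').symm j))
  obtain ⟨hsg, hl, F, hF, hFw⟩ := exists_zeroFlags_circuit S n le_rfl
  let eI' : I ⊕ (Z ⊕ Fin (n + 1)) ≃ W ⊕ Fin (n + 1) :=
    (Equiv.sumAssoc _ _ _).symm.trans (Equiv.sumCongr eI (Equiv.refl _))
  obtain ⟨M, hM, hacc⟩ := QAlg.exists_of_circuit eI'
    (gs.map (QGate.map (wireEmbedding (Equiv.refl (W ⊕ Fin (n + 1))))) ++ hsg)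
    (Sum.inr (Fin.last n))
  refine ⟨M, ?_, ?_⟩
  · have hU : ∀ (v₁ : Bits W) (v₂ : Bits (Fin (n + 1))) (i : Bits I),
        circuitUnitary (gs.map (QGate.map (wireEmbedding (Equiv.refl (W ⊕ Fin (n + 1)))))
          ++ hsg) (Sum.elim v₁ v₂) (padBits eI' i) =
        if v₂ = zeroFlags S v₁ n then circuitUnitary gs v₁ (padBits eI i) else 0 := by
      intro v₁ v₂ i
      rw [circuitUnitary_append, hF, circuitUnitary_map, Matrix.mul_apply,
        ← (splitBits (Equiv.refl (W ⊕ Fin (n + 1)))).symm.sum_comp, Fintype.sum_prod_type]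
      have h5 : padBits eI' i ∘ (Equiv.refl (W ⊕ Fin (n + 1))) ∘ Sum.inl = padBits eI i := by
        funext x
        obtain ⟨y, rfl⟩ := eI.surjective x
        rcases y with y | y <;> simp [padBits, eI', zeroBits]
      have h6 : padBits eI' i ∘ (Equiv.refl (W ⊕ Fin (n + 1))) ∘ Sum.inr = zeroBits _ := by
        funext x
        simp [padBits, eI', zeroBits]
      have h7 : ∀ (w : Bits W) (z : Bits (Fin (n + 1))),
          (splitBits (Equiv.refl (W ⊕ Fin (n + 1)))).symm (w, z) = Sum.elim w z :=
        fun w z => rfl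
      have h8 : ∀ (w : Bits W) (z : Bits (Fin (n + 1))),
          Sum.elim w z ∘ (Equiv.refl (W ⊕ Fin (n + 1))) ∘ Sum.inl = w := fun w z => rfl
      have h9 : ∀ (w : Bits W) (z : Bits (Fin (n + 1))),
          Sum.elim w z ∘ (Equiv.refl (W ⊕ Fin (n + 1))) ∘ Sum.inr = z := fun w z => rfl
      have h10 : ∀ w : Bits W, Sum.elim v₁ v₂ = Sum.elim w (zeroFlags S w n) ↔
          v₁ = w ∧ v₂ = zeroFlags S v₁ n := by
        intro w
        constructor
        · intro h
          have h1 : v₁ = w := funext fun x => congrFun h (Sum.inl x)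
          subst h1
          exact ⟨rfl, funext fun x => congrFun h (Sum.inr x)⟩
        · rintro ⟨rfl, h⟩
          rw [← h]
      simp only [liftWires, basisMap, of_apply, h5, h6, h7, h8, h9, mul_ite, mul_zero,
        Finset.sum_ite_eq', Finset.mem_univ, if_true, hFw, h10, ite_and, ite_mul, one_mul,
        zero_mul, Finset.sum_ite_eq]
    ext i i'
    rw [hacc, ← (Equiv.sumArrowEquivProdArrow _ _ _).symm.sum_comp, Fintype.sum_prod_type]
    have h11 : ∀ (w : Bits W) (z : Bits (Fin (n + 1))),
        (Equiv.sumArrowEquivProdArrow _ _ _).symm (w, z) = Sum.elim w z := fun w z => rfl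
    simp only [h11, hU, Sum.elim_inr]
    have h12 : ∀ w : Bits W, zeroFlags S w n (Fin.last n) = true ↔
        w ∘ eO ∘ Sum.inr = zeroBits Z' := by
      intro w
      simp only [zeroFlags, Fin.val_last, le_refl, true_and, Fin.is_lt, forall_true_left,
        decide_eq_true_eq, S, (Fintype.equivFin Z').symm.forall_congr_left, funext_iff]
      exact ⟨fun h x => by simpa [zeroBits] using h (Fintype.equivFin Z' x), fun h i => h _⟩
    trans ∑ w : Bits W, if w ∘ eO ∘ Sum.inr = zeroBits Z' then
      star (circuitUnitary gs w (padBits eI i)) * circuitUnitary gs w (padBits eI i') else 0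
    · refine Finset.sum_congr rfl fun w _ => ?_
      rw [Fintype.sum_eq_single (zeroFlags S w n)]
      · simp only [h12, if_true]
      · intro z hz
        simp [hz]
    · rw [← (splitBits eO).symm.sum_comp, Fintype.sum_prod_type, Matrix.mul_apply]
      refine Finset.sum_congr rfl fun o _ => ?_
      rw [Fintype.sum_eq_single (zeroBits _)]
      · rw [if_pos (by funext x; simp [splitBits, zeroBits])]
        rfl
      · intro z hz
        rw [if_neg]
        intro h
        apply hz
        rw [← h]
        funext x
        simp [splitBits]
  -- There are n + 1 flag wires and 3n + 1 flag gates, with n at most the number of wires, so at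
  -- most s + 4n + 2 ≤ 5s + 2 in all.
  · rw [hM, List.length_append, List.length_map, hl, Fintype.card_sum, Fintype.card_fin]
    omega

/-- The isometry `|x⟩ ↦ |x ∘ g⟩ |x⟩`. -/
def copyOp (g : Y → X) : Matrix (Bits (Y ⊕ X)) (Bits X) ℂ :=
  basisMap fun x => Sum.elim (x ∘ g) x

/-- Distinct targets are needed because a repeated CNOT would undo the copy. -/
theorem circuitUnitary_copy (g : Y → X) (l : List Y) (hl : l.Nodup) :
    circuitUnitary (l.map fun y => QGate.cnot (Sum.inr (g y)) (Sum.inl y) Sum.inr_ne_inl) =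
      basisMap fun v : Bits (Y ⊕ X) => Sum.elim
        (fun y => if y ∈ l then xor (v (Sum.inl y)) (v (Sum.inr (g y))) else v (Sum.inl y))
        (v ∘ Sum.inr) := by
  induction l with
  | nil =>
    rw [List.map_nil, circuitUnitary_nil, ← basisMap_id]
    congr 1
    funext v x
    rcases x with x | x <;> simp
  | cons y l ih =>
    rw [List.map_cons, circuitUnitary_cons, ih hl.of_cons, QGate.matrix_cnot, basisMap_mul]
    congr 1
    funext v x
    rcases x with x | x
    · have hy : y ∉ l := (List.nodup_cons.mp hl).1
      by_cases hx : x = y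
      · subst hx; simp [hy]
      · simp [hx]
    · simp

theorem realizable_copyOp (g : Y → X) :
    Realizable (copyOp g) (Fintype.card X + 2 * Fintype.card Y) := by
  refine ⟨Y ⊕ X, Y, Empty, inferInstance, inferInstance, inferInstance, inferInstance,
    inferInstance, inferInstance, Equiv.sumComm _ _, Equiv.sumEmpty _ _,
    (Finset.univ : Finset Y).toList.map
      fun y => QGate.cnot (Sum.inr (g y)) (Sum.inl y) Sum.inr_ne_inl, ?_, ?_⟩
  · simp; omega
  · rw [circuitUnitary_copy g _ (Finset.nodup_toList _)]
    ext o i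
    simp only [copyOp, basisMap, of_apply, submatrix_apply]
    have h1 : padBits (Equiv.sumEmpty (Y ⊕ X) Empty) o = o := by
      funext x; simp [padBits]
    have h2 : (Sum.elim (i ∘ g) i : Bits (Y ⊕ X)) = Sum.elim
        (fun y => if y ∈ (Finset.univ : Finset Y).toList then
          xor (padBits (Equiv.sumComm X Y) i (Sum.inl y))
            (padBits (Equiv.sumComm X Y) i (Sum.inr (g y)))
          else padBits (Equiv.sumComm X Y) i (Sum.inl y))
        (padBits (Equiv.sumComm X Y) i ∘ Sum.inr) := by
      funext x
      rcases x with x | x <;> simp [padBits, zeroBits]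
    exact if_congr (by rw [h1, ← h2]) rfl rfl

end Realization

/-! ### Action of circuits on states, and its Heisenberg dual. -/

namespace QAlg

variable {I O E : Type} [Fintype I] [DecidableEq I] [Fintype O] [DecidableEq O]
  [Fintype E] [DecidableEq E]

theorem run_apply (M : QAlg I O) (ρ : Matrix (Bits I) (Bits I) ℂ) (o o' : Bits O) :
    M.run ρ o o' = ∑ d, ∑ i', ∑ i, M.kraus d o i * ρ i i' * star (M.kraus d o' i') := by
  simp only [run, Matrix.sum_apply, Matrix.mul_apply, conjTranspose_apply, Finset.sum_mul]

theorem runWith_apply (M : QAlg I O) (ρ : Matrix (Bits I × E) (Bits I × E) ℂ)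
    (u v : Bits O × E) :
    M.runWith ρ u v = M.run (Matrix.of fun i i' => ρ (i, u.2) (i', v.2)) u.1 v.1 := by
  simp only [run_apply, runWith, Matrix.sum_apply, Matrix.mul_apply, conjTranspose_apply,
    kroneckerMap_apply, Fintype.sum_prod_type, Matrix.one_apply, mul_ite, mul_one, mul_zero,
    ite_mul, zero_mul, Finset.sum_ite_eq, Finset.mem_univ, if_true, Finset.sum_mul, of_apply,
    apply_ite star, star_zero, Finset.sum_ite_irrel, Finset.sum_const_zero]

theorem run_sum {ι : Type} (s : Finset ι) (M : QAlg I O)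
    (ρ : ι → Matrix (Bits I) (Bits I) ℂ) : M.run (∑ y ∈ s, ρ y) = ∑ y ∈ s, M.run (ρ y) := by
  simp only [run]
  rw [Finset.sum_comm]
  refine Finset.sum_congr rfl fun d _ => ?_
  rw [Matrix.mul_sum, Matrix.sum_mul]

theorem run_smul (M : QAlg I O) (ρ : Matrix (Bits I) (Bits I) ℂ) (x : ℂ) :
    M.run (x • ρ) = x • M.run ρ := by
  simp [run, Finset.smul_sum]

theorem run_single (M : QAlg I O) (k : Bits I) (o o' : Bits O) :
    M.run (Matrix.single k k 1) o o' = ∑ d, M.kraus d o k * star (M.kraus d o' k) := by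
  rw [run_apply]
  refine Finset.sum_congr rfl fun d _ => ?_
  simp [Matrix.single_apply, ite_and]

theorem sum_kraus_normSq (M : QAlg I O) (k : Bits I) :
    ∑ d, ∑ z, star (M.kraus d z k) * M.kraus d z k = 1 := by
  have h := congrFun (congrFun M.sum_kraus_conjTranspose_mul k) k
  simpa only [Matrix.sum_apply, Matrix.mul_apply, conjTranspose_apply, Matrix.one_apply_eq]
    using h

theorem runWith_posSemidef (M : QAlg I O) {ρ : Matrix (Bits I × E) (Bits I × E) ℂ}
    (hρ : ρ.PosSemidef) : (M.runWith ρ).PosSemidef :=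
  Matrix.posSemidef_sum _ fun _ _ => hρ.mul_mul_conjTranspose_same _

theorem trace_runWith (M : QAlg I O) (ρ : Matrix (Bits I × E) (Bits I × E) ℂ) :
    (M.runWith ρ).trace = ρ.trace := by
  rw [runWith, Matrix.trace_sum]
  simp only [Matrix.trace_mul_cycle, conjTranspose_kronecker, ← Matrix.mul_kronecker_mul,
    conjTranspose_one, Matrix.mul_one]
  rw [← Matrix.trace_sum, ← Finset.sum_mul]
  have : ∑ d, ((M.kraus d)ᴴ * M.kraus d) ⊗ₖ (1 : Matrix E E ℂ) = 1 := by
    rw [← Matrix.one_kronecker_one, ← M.sum_kraus_conjTranspose_mul]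
    ext u v
    simp [Matrix.sum_apply, Finset.sum_mul]
  rw [this, Matrix.one_mul]

/-- Heisenberg picture of `run`. -/
def pull (M : QAlg I O) (G : Matrix (Bits O) (Bits O) ℂ) : Matrix (Bits I) (Bits I) ℂ :=
  ∑ d, (M.kraus d)ᴴ * G * M.kraus d

theorem trace_pull_mul (M : QAlg I O) (G : Matrix (Bits O) (Bits O) ℂ)
    (ρ : Matrix (Bits I) (Bits I) ℂ) : (M.pull G * ρ).trace = (G * M.run ρ).trace := by
  simp only [pull, run, Finset.sum_mul, Finset.mul_sum, Matrix.trace_sum]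
  refine Finset.sum_congr rfl fun d _ => ?_
  rw [← Matrix.mul_assoc, Matrix.trace_mul_comm (G * _), Matrix.mul_assoc, Matrix.mul_assoc]

end QAlg

/-! ### Both experiments and the distinguisher as traces against one state. -/

namespace CQOp

variable {a b c l aB aC : ℕ}

/-- Grouping the registers `(B, A_B)` and `(C, A_C)` of `((A_B, A_C), B, C)`. -/
def groupRegisters (a b c d : ℕ) :
    Bits (Fin b ⊕ Fin a) × (Bits (Fin c) × Bits (Fin d)) ≃
      Bits (Fin a ⊕ Fin d) × Bits (Fin b) × Bits (Fin c) where
  toFun u := (Sum.elim (u.1 ∘ Sum.inr) u.2.2, u.1 ∘ Sum.inl, u.2.1)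
  invFun u := (Sum.elim u.2.1 (u.1 ∘ Sum.inl), (u.2.2, u.1 ∘ Sum.inr))
  left_inv u := by simp
  right_inv u := by simp

/-- The state of `((B, A_B), (C, A_C))` after running `A`, together with the string being `k`. -/
def splitState (ρ : CQOp a b c l) (algA : QAlg (Fin a) (Fin aB ⊕ Fin aC)) (k : Bits (Fin l)) :
    Matrix (Bits (Fin b ⊕ Fin aB) × (Bits (Fin c) × Bits (Fin aC)))
      (Bits (Fin b ⊕ Fin aB) × (Bits (Fin c) × Bits (Fin aC))) ℂ :=
  (algA.runWith (ρ k)).submatrix (groupRegisters aB b c aC) (groupRegisters aB b c aC)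

/-- The inputs of `C` for a fixed value `k` of the string. -/
def withKey {c l aC : ℕ} (k : Bits (Fin l)) (u : Bits (Fin c) × Bits (Fin aC)) :
    Bits (Fin c ⊕ Fin l ⊕ Fin aC) :=
  Sum.elim u.1 (Sum.elim k u.2)

theorem splitState_posSemidef {ρ : CQOp a b c l} (hρ : ρ.IsState)
    (algA : QAlg (Fin a) (Fin aB ⊕ Fin aC)) (k : Bits (Fin l)) :
    (ρ.splitState algA k).PosSemidef :=
  (algA.runWith_posSemidef (hρ.1 k)).submatrix _

theorem trace_submatrix_equiv {m n : Type} [Fintype m] [Fintype n] (e : m ≃ n)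
    (M : Matrix n n ℂ) : (M.submatrix e e).trace = M.trace :=
  e.sum_comp fun i => M i i

theorem trace_splitState (ρ : CQOp a b c l) (algA : QAlg (Fin a) (Fin aB ⊕ Fin aC))
    (k : Bits (Fin l)) : (ρ.splitState algA k).trace = (ρ k).trace := by
  rw [splitState, trace_submatrix_equiv, QAlg.trace_runWith]

theorem simultProb_eq (ρ : CQOp a b c l) (algA : QAlg (Fin a) (Fin aB ⊕ Fin aC))
    (algB : QTest (Fin b ⊕ Fin aB)) (algC : QAlg (Fin c ⊕ Fin l ⊕ Fin aC) Unit) :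
    ρ.simultProb algA algB algC = ∑ k,
      ((algB.effect ⊗ₖ algC.accept.submatrix (withKey k) (withKey k)) *
        ρ.splitState algA k).trace.re := by
  unfold simultProb
  refine Finset.sum_congr rfl fun k _ => ?_
  dsimp only
  rw [← trace_submatrix_equiv (groupRegisters aB b c aC),
    ← Matrix.submatrix_mul_equiv _ _ _ (groupRegisters aB b c aC)]
  congr 4
  ext u v
  simp [groupRegisters, withKey]

/-- The circuit for A and the replacement of C act on different registers, so they commute. -/
theorem splitState_replaceC (ρ : CQOp a b c l) (algD : QAlg (Fin l) (Fin c))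
    (algA : QAlg (Fin a) (Fin aB ⊕ Fin aC)) (k : Bits (Fin l)) :
    (ρ.replaceC algD).splitState algA k =
      replaceState (ρ.splitState algA k) fun d z => algD.kraus d z k := by
  ext u v
  simp only [splitState, submatrix_apply, replaceState, of_apply, QAlg.runWith_apply,
    ← QAlg.run_single, ← Matrix.sum_apply, groupRegisters, Equiv.coe_fn_mk]
  rw [← QAlg.run_sum, mul_comm, ← smul_eq_mul, ← Matrix.smul_apply,
    ← QAlg.run_smul]
  congr 2
  ext i i'
  simp [replaceC, Matrix.sum_apply, mul_comm]

/-- The probability that a distinguisher accepts, if its effect is the pullback under `A` of an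
effect `H k` on `(C, A_C)`. -/
theorem viewProb_eq (ρ : CQOp a b c l) (M : QAlg (Fin a ⊕ Fin c ⊕ Fin l) Unit)
    (algA : QAlg (Fin a) (Fin aB ⊕ Fin aC))
    (H : Bits (Fin l) → Matrix (Bits (Fin c) × Bits (Fin aC)) (Bits (Fin c) × Bits (Fin aC)) ℂ)
    (hM : ∀ k x z x' z', M.accept (Sum.elim x (Sum.elim z k)) (Sum.elim x' (Sum.elim z' k)) =
      algA.pull (Matrix.of fun o o' => if o ∘ Sum.inl = o' ∘ Sum.inl then
        H k (z, o ∘ Sum.inr) (z', o' ∘ Sum.inr) else 0) x x') :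
    ρ.viewProb M = ∑ k, (((1 : Matrix (Bits (Fin b ⊕ Fin aB)) _ ℂ) ⊗ₖ H k) *
      ρ.splitState algA k).trace.re := by
  unfold viewProb
  refine Finset.sum_congr rfl fun k _ => ?_
  dsimp only
  congr 1
  let G : Bits (Fin c) → Bits (Fin c) →
      Matrix (Bits (Fin aB ⊕ Fin aC)) (Bits (Fin aB ⊕ Fin aC)) ℂ := fun z z' =>
    Matrix.of fun o o' => if o ∘ Sum.inl = o' ∘ Sum.inl then
        H k (z, o ∘ Sum.inr) (z', o' ∘ Sum.inr) else 0
  let S : Bits (Fin b) → Bits (Fin c) → Bits (Fin c) → Matrix (Bits (Fin a)) (Bits (Fin a)) ℂ :=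
    fun y z' z => Matrix.of fun x' x => ρ k (x', y, z') (x, y, z)
  have hsplit : ∀ p q, (Equiv.sumArrowEquivProdArrow (Fin aB) (Fin aC) Bool).symm (p, q) =
      Sum.elim p q := fun _ _ => rfl
  -- Both sides are split over the indices of C and the diagonal index of B; what remains is a trace
  -- on the output of A, where `QAlg.trace_pull_mul` applies.
  trans ∑ z, ∑ z', ∑ y, (G z z' * algA.run (S y z' z)).trace
  · have h : ∀ z z', ∑ y, (G z z' * algA.run (S y z' z)).trace =
        (algA.pull (G z z') * ∑ y, S y z' z).trace := by
      intro z z'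
      rw [QAlg.trace_pull_mul, QAlg.run_sum, Finset.mul_sum, Matrix.trace_sum]
    simp only [h]
    simp only [Matrix.trace, Matrix.diag, Matrix.mul_apply, Fintype.sum_prod_type,
      submatrix_apply, hM, of_apply, Matrix.sum_apply, S]
    rw [Finset.sum_comm]
    refine Finset.sum_congr rfl fun z _ => ?_
    simp_rw [Finset.sum_comm (s := (Finset.univ : Finset (Bits (Fin a))))
      (t := (Finset.univ : Finset (Bits (Fin c))))]
    rfl
  · rw [Matrix.trace, ← (Equiv.prodCongr (Equiv.sumArrowEquivProdArrow _ _ _)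
      (Equiv.refl _)).symm.sum_comp]
    simp only [Matrix.diag, Matrix.mul_apply, kroneckerMap_apply, Matrix.one_apply,
      Fintype.sum_prod_type (γ := ℂ) (α₁ := Bits (Fin b ⊕ Fin aB)), ite_mul, one_mul, zero_mul,
      Finset.sum_ite_irrel, Finset.sum_const_zero, Finset.sum_ite_eq, Finset.mem_univ, if_true]
    rw [Fintype.sum_prod_type]
    simp only [Fintype.sum_prod_type (α₁ := Bits (Fin c))]
    conv_rhs => rw [Finset.sum_comm]
    refine Finset.sum_congr rfl fun z _ => ?_
    simp_rw [Finset.sum_comm (s := (Finset.univ : Finset (Bits (Fin aC))))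
      (t := (Finset.univ : Finset (Bits (Fin c))))]
    conv_rhs => rw [Finset.sum_comm]
    refine Finset.sum_congr rfl fun z' _ => ?_
    rw [Fintype.sum_prod_type]
    refine Finset.sum_congr rfl fun y _ => ?_
    rw [Matrix.trace, ← (Equiv.sumArrowEquivProdArrow _ _ _).symm.sum_comp,
      Fintype.sum_prod_type]
    refine Finset.sum_congr rfl fun ob _ => Finset.sum_congr rfl fun oc _ => ?_
    rw [Matrix.diag, Matrix.mul_apply, ← (Equiv.sumArrowEquivProdArrow _ _ _).symm.sum_comp,
      Fintype.sum_prod_type, Fintype.sum_eq_single ob]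
    · refine Finset.sum_congr rfl fun oc' _ => ?_
      simp only [G, S, splitState, submatrix_apply, QAlg.runWith_apply, of_apply, hsplit,
        Sum.elim_comp_inl, Sum.elim_comp_inr, if_true]
      rfl
    · intro ob' h
      refine Finset.sum_eq_zero fun oc' _ => ?_
      have hG : G z z' (Sum.elim ob oc) (Sum.elim ob' oc') = 0 :=
        if_neg fun h' => h (funext fun w => (congrFun h' w).symm)
      simp only [hsplit, hG, zero_mul]

end CQOp

/-! ### Composing an operator with a circuit, and restricting powers to a block. -/

section Guard

variable {I O X G : Type} [Fintype I] [DecidableEq I] [Fintype O] [DecidableEq O]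
  [Fintype X] [DecidableEq X] [Fintype G] [DecidableEq G]

theorem tensorOne_conjTranspose_mul (A : Matrix (Bits O) (Bits I) ℂ) :
    (tensorOne X A)ᴴ * tensorOne X A = tensorOne X (Aᴴ * A) := by
  ext i i'
  rw [Matrix.mul_apply, ← (Equiv.sumArrowEquivProdArrow _ _ _).symm.sum_comp,
    Fintype.sum_prod_type]
  have h1 : ∀ (x : Bits O) (y : Bits X),
      ((Equiv.sumArrowEquivProdArrow O X Bool).symm (x, y)) ∘ Sum.inl = x := fun x y => rfl
  have h2 : ∀ (x : Bits O) (y : Bits X),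
      ((Equiv.sumArrowEquivProdArrow O X Bool).symm (x, y)) ∘ Sum.inr = y := fun x y => rfl
  simp only [tensorOne, conjTranspose_apply, of_apply, h1, h2, apply_ite star, star_zero,
    ite_mul, zero_mul, mul_ite, mul_zero, Finset.sum_ite_eq', Finset.mem_univ, if_true]
  by_cases h : i ∘ Sum.inr = i' ∘ Sum.inr
  · simp [h, Matrix.mul_apply]
  · simp [h, Ne.symm h]

theorem tensorOne_submatrix_conjTranspose_mul {J : Type} (A : Matrix (Bits O) (Bits I) ℂ)
    (f : J → Bits (I ⊕ X)) :
    ((tensorOne X A).submatrix (fun o => o ∘ Equiv.refl _) f)ᴴ *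
      (tensorOne X A).submatrix (fun o => o ∘ Equiv.refl _) f =
      (tensorOne X (Aᴴ * A)).submatrix f f := by
  rw [← tensorOne_conjTranspose_mul]
  rfl

/-- Run `M` on `I`, then apply `R` to its output and the spectator register `X`. -/
theorem Realizable.exists_pull (M : QAlg I O) {R : Matrix (Bits G) (Bits (O ⊕ X)) ℂ} {t : ℕ}
    (hR : Realizable R t) :
    ∃ A : Matrix (Bits (G ⊕ Fin M.disc)) (Bits (I ⊕ X)) ℂ,
      Realizable A (t + 2 * M.size + Fintype.card X) ∧ ∀ i r i' r',
        (Aᴴ * A) (Sum.elim i r) (Sum.elim i' r') =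
          M.pull (Matrix.of fun o o' => (Rᴴ * R) (Sum.elim o r) (Sum.elim o' r')) i i' := by
  let e : (O ⊕ Fin M.disc) ⊕ X ≃ (O ⊕ X) ⊕ Fin M.disc :=
    (Equiv.sumAssoc _ _ _).trans ((Equiv.sumCongr (Equiv.refl _) (Equiv.sumComm _ _)).trans
      (Equiv.sumAssoc _ _ _).symm)
  let V : Matrix (Bits ((O ⊕ X) ⊕ Fin M.disc)) (Bits (I ⊕ X)) ℂ :=
    (tensorOne X M.isometry).submatrix (fun o => o ∘ e) (fun i => i ∘ Equiv.refl _)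
  have hV : Realizable V (M.size + Fintype.card X) :=
    (M.realizable_isometry.tensor_one (X := X)).reindex e (Equiv.refl _)
  have hdisc : M.disc ≤ M.size := by
    have := Fintype.card_congr M.out
    simp only [Fintype.card_sum, Fintype.card_fin] at this
    simp only [QAlg.size]
    omega
  -- The discarded wires of `M` survive as outputs of the operator; forming A†A sums over them,
  -- which is the partial trace.
  refine ⟨tensorOne (Fin M.disc) R * V, ((hR.tensor_one (X := Fin M.disc)).mul hV).mono
    (by simp only [Fintype.card_fin]; omega), fun i r i' r' => ?_⟩
  have hVa : ∀ o s d i r, V (Sum.elim (Sum.elim o s) d) (Sum.elim i r) =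
      if s = r then M.kraus d o i else 0 := by
    intro o s d i r
    have h1 : (Sum.elim (Sum.elim o s) d : Bits ((O ⊕ X) ⊕ Fin M.disc)) ∘ e =
        Sum.elim (Sum.elim o d) s := by
      funext x; rcases x with (x | x) | x <;> rfl
    simp only [V, submatrix_apply, h1]
    simp only [tensorOne, QAlg.isometry, of_apply]
    by_cases h : s = r <;> simp [h]
  have hsum : ∀ f : Bits ((O ⊕ X) ⊕ Fin M.disc) → ℂ,
      ∑ w, f w = ∑ d, ∑ o, ∑ s, f (Sum.elim (Sum.elim o s) d) := by
    intro f
    rw [← (Equiv.sumArrowEquivProdArrow _ _ _).symm.sum_comp, Fintype.sum_prod_type,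
      Finset.sum_comm]
    refine Finset.sum_congr rfl fun d _ => ?_
    rw [← (Equiv.sumArrowEquivProdArrow _ _ _).symm.sum_comp, Fintype.sum_prod_type]
    rfl
  rw [conjTranspose_mul, Matrix.mul_assoc, ← Matrix.mul_assoc (tensorOne _ R)ᴴ,
    tensorOne_conjTranspose_mul, QAlg.pull, Matrix.mul_apply, hsum, Matrix.sum_apply]
  refine Finset.sum_congr rfl fun d _ => ?_
  simp only [Matrix.mul_apply (M := tensorOne _ _), hsum, hVa, conjTranspose_apply]
  rw [Matrix.mul_assoc, Matrix.mul_apply]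
  refine Finset.sum_congr rfl fun o _ => ?_
  rw [Fintype.sum_eq_single r (by intro s hs; simp [hs])]
  rw [Matrix.mul_apply, if_pos rfl, Fintype.sum_eq_single d]
  · congr 1
    refine Finset.sum_congr rfl fun o' _ => ?_
    rw [Fintype.sum_eq_single r' (by intro s hs; simp [hs])]
    simp [tensorOne]
  · intro d' hd'
    refine Finset.sum_eq_zero fun o' _ => Finset.sum_eq_zero fun s _ => ?_
    simp [tensorOne, hd'.symm]

variable {κ ξ ι : Type} [Fintype κ] [DecidableEq κ] [Fintype ξ] [DecidableEq ξ]

/-- Rows of `N` indexed by the range of `s` vanish outside it, so a product never leaves the block.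
It is used for the block of a fixed string `k`. -/
theorem submatrix_pow_mul {N : Matrix ξ ξ ℂ} {s : κ → ξ} (hs : Function.Injective s)
    (hN : ∀ i x, x ∉ Set.range s → N (s i) x = 0) {ι' : Type} (M : Matrix ξ ι' ℂ) (g : ι → ι') (T : ℕ) :
    (N ^ T * M).submatrix s g = (N.submatrix s s) ^ T * M.submatrix s g := by
  induction T with
  | zero => simp
  | succ T ih =>
    rw [pow_succ', pow_succ', Matrix.mul_assoc, Matrix.mul_assoc, ← ih]
    ext i j
    rw [submatrix_apply, Matrix.mul_apply, Matrix.mul_apply]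
    refine (Fintype.sum_of_injective s hs _ _ (fun x hx => ?_) fun x => rfl).symm
    rw [hN i x hx, zero_mul]

theorem submatrix_pow_mul_mul_pow {N : Matrix ξ ξ ℂ} {s : κ → ξ} (hs : Function.Injective s)
    (hN : ∀ i x, x ∉ Set.range s → N (s i) x = 0) (hN' : Nᴴ = N) (M : Matrix ξ ξ ℂ) (T : ℕ) :
    (N ^ T * M * N ^ T).submatrix s s =
      (N.submatrix s s) ^ T * M.submatrix s s * (N.submatrix s s) ^ T := by
  have h := congrArg conjTranspose (submatrix_pow_mul hs hN Mᴴ s T)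
  have hNs : (N.submatrix s s)ᴴ = N.submatrix s s := by rw [conjTranspose_submatrix, hN']
  rw [conjTranspose_submatrix, conjTranspose_mul, conjTranspose_mul, conjTranspose_pow, hN',
    conjTranspose_pow, hNs, conjTranspose_submatrix, conjTranspose_conjTranspose] at h
  rw [Matrix.mul_assoc, submatrix_pow_mul hs hN, h, Matrix.mul_assoc]

end Guard

/-! ### The fresh test and the guarded distinguisher as circuits. -/

section Distinguisher

variable {a c l aB aC : ℕ}

open CQOp

/-- Test `(C, k, A_C)` by running `algC` with a fresh sample of `algD` in place of `C`. -/
theorem exists_freshTest (algD : QAlg (Fin l) (Fin c))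
    (algC : QAlg (Fin c ⊕ Fin l ⊕ Fin aC) Unit) :
    ∃ M : QAlg (Fin c ⊕ Fin l ⊕ Fin aC) Unit, M.size ≤ 45 * algC.size + 10 * algD.size + 7 ∧
      (∀ k u x, x ∉ Set.range (withKey k) → M.accept (withKey k u) x = 0) ∧
      ∀ k, M.accept.submatrix (withKey k) (withKey k) =
        (1 : Matrix (Bits (Fin c)) (Bits (Fin c)) ℂ) ⊗ₖ
          averageEffect (fun d z => algD.kraus d z k)
            (algC.accept.submatrix (withKey k) (withKey k)) := by
  -- `algC` reads the fresh sample, a copy of the string, and A_C. The original C and the original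
  -- string remain spectators, which makes the effect the identity on C and block diagonal in the
  -- string.
  let e : (Fin c ⊕ Fin l ⊕ Fin aC) ⊕ (Fin c ⊕ Fin l) ≃
      Fin c ⊕ (Fin l ⊕ (Fin c ⊕ (Fin l ⊕ Fin aC))) :=
    { toFun := fun
        | .inl (.inl x) => .inl x
        | .inl (.inr (.inl x)) => .inr (.inl x)
        | .inl (.inr (.inr x)) => .inr (.inr (.inr (.inr x)))
        | .inr (.inl x) => .inr (.inr (.inl x))
        | .inr (.inr x) => .inr (.inr (.inr (.inl x)))
      invFun := fun
        | .inl x => .inl (.inl x)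
        | .inr (.inl x) => .inl (.inr (.inl x))
        | .inr (.inr (.inl x)) => .inr (.inl x)
        | .inr (.inr (.inr (.inl x))) => .inr (.inr x)
        | .inr (.inr (.inr (.inr x))) => .inl (.inr (.inr x))
      left_inv := by rintro ((x | x | x) | x | x) <;> rfl
      right_inv := by rintro (x | x | x | x | x) <;> rfl }
  have hR := (algC.realizable_outcomeOp_true.tensor_one (X := Fin c ⊕ Fin l)).reindex
    (Equiv.refl _) e
  obtain ⟨A, hA, hAa⟩ := hR.exists_pull algD
  -- Two copies of the string: one is consumed by `algD`, the other by `algC`.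
  let g : Fin l ⊕ Fin l → Fin c ⊕ Fin l ⊕ Fin aC :=
    Sum.elim (fun x => .inr (.inl x)) (fun x => .inr (.inl x))
  have hcopy := (realizable_copyOp g).reindex (Equiv.sumAssoc _ _ _) (Equiv.refl _)
  obtain ⟨M, hM, hsize⟩ := (hA.mul hcopy).exists_qalg
  have hcl : c + (l + aC) ≤ algC.size := by
    simp only [QAlg.size, Fintype.card_sum, Fintype.card_fin]; omega
  have hl : l ≤ algD.size := by simp only [QAlg.size, Fintype.card_fin]; omega
  have hacc : ∀ x x' : Bits (Fin c ⊕ Fin l ⊕ Fin aC), M.accept x x' =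
      algD.pull (Matrix.of fun o o' =>
        if x ∘ Sum.inl = x' ∘ Sum.inl ∧ x ∘ Sum.inr ∘ Sum.inl = x' ∘ Sum.inr ∘ Sum.inl then
          algC.accept (Sum.elim o (x ∘ Sum.inr)) (Sum.elim o' (x' ∘ Sum.inr)) else 0)
        (x ∘ Sum.inr ∘ Sum.inl) (x' ∘ Sum.inr ∘ Sum.inl) := by
    let φ : Bits (Fin c ⊕ Fin l ⊕ Fin aC) →
        Bits (Fin l ⊕ (Fin l ⊕ (Fin c ⊕ (Fin l ⊕ Fin aC)))) := fun x =>
      Sum.elim (x ∘ Sum.inr ∘ Sum.inl) (Sum.elim (x ∘ Sum.inr ∘ Sum.inl) x)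
    have hcomp : A * (copyOp g).submatrix (fun o => o ∘ Equiv.sumAssoc _ _ _)
        (fun i => i ∘ Equiv.refl _) = A.submatrix id φ := by
      ext y x
      rw [Matrix.mul_apply, Fintype.sum_eq_single (φ x)]
      · rw [submatrix_apply, copyOp, basisMap, of_apply, if_pos, mul_one]
        · rfl
        · funext w
          rcases w with (w | w) | w <;> rfl
      · intro w hw
        rw [submatrix_apply, copyOp, basisMap, of_apply, if_neg, mul_zero]
        intro h
        apply hw
        funext v
        rcases v with v | v | v
        · exact congrFun h (Sum.inl (Sum.inl v))
        · exact congrFun h (Sum.inl (Sum.inr v))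
        · exact congrFun h (Sum.inr v)
    intro x x'
    have hφ : ((A.submatrix id φ)ᴴ * A.submatrix id φ) x x' = (Aᴴ * A) (φ x) (φ x') := rfl
    rw [hM, hcomp, hφ, hAa, tensorOne_submatrix_conjTranspose_mul, ← QAlg.accept_eq]
    congr 2
    ext o o'
    simp only [of_apply, submatrix_apply, tensorOne]
    refine if_congr ?_ ?_ rfl
    · constructor
      · intro h
        exact ⟨funext fun w => congrFun h (Sum.inl w), funext fun w => congrFun h (Sum.inr w)⟩
      · rintro ⟨h1, h2⟩
        funext w
        rcases w with w | w
        · exact congrFun h1 w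
        · exact congrFun h2 w
    · congr 1 <;> (funext w; rcases w with w | w | w <;> rfl)
  refine ⟨M, ?_, ?_, ?_⟩
  -- The operator costs |algC| + 2|algD| + 1 + (3c + 8l + 2aC) ≤ 9|algC| + 2|algD| + 1, and
  -- `Realizable.exists_qalg` maps s to 5s + 2.
  · simp only [Fintype.card_sum, Fintype.card_fin] at hsize
    omega
  · intro k u x hx
    rw [hacc]
    have hk : ¬ k = x ∘ Sum.inr ∘ Sum.inl := by
      rintro rfl
      refine hx ⟨(x ∘ Sum.inl, x ∘ Sum.inr ∘ Sum.inr), ?_⟩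
      funext y
      rcases y with y | y | y <;> rfl
    have h0 : (withKey k u ∘ Sum.inr ∘ Sum.inl : Bits (Fin l)) = k := rfl
    simp only [h0, hk, and_false, if_false]
    have : (Matrix.of fun (_ _ : Bits (Fin c)) => (0 : ℂ)) = 0 := rfl
    simp [QAlg.pull, this]
  · intro k
    ext ⟨z, α⟩ ⟨z', α'⟩
    rw [submatrix_apply, hacc, kroneckerMap_apply, averageEffect_apply, QAlg.pull,
      Matrix.sum_apply, Matrix.one_apply]
    have h0 : ∀ (z : Bits (Fin c)) (α : Bits (Fin aC)), (withKey k (z, α) ∘ Sum.inr ∘ Sum.inl : Bits (Fin l)) = k :=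
      fun _ _ => rfl
    have h1 : ∀ (z : Bits (Fin c)) (α : Bits (Fin aC)), (withKey (l := l) k (z, α) ∘ Sum.inl : Bits (Fin c)) = z :=
      fun _ _ => rfl
    simp only [h0, h1, and_true]
    by_cases hz : z = z'
    · simp only [hz, if_true, one_mul, Matrix.mul_apply, Finset.sum_mul, conjTranspose_apply,
        of_apply, submatrix_apply]
      refine Finset.sum_congr rfl fun d _ => ?_
      rw [Finset.sum_comm]
      rfl
    · have : (Matrix.of fun (_ _ : Bits (Fin c)) => (0 : ℂ)) = 0 := rfl
      simp [hz, this]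

/-- The distinguisher: run `algA`, apply the complement of the fresh test `T` times to
`(C, k, A_C)`, and then run `algC`. -/
theorem exists_distinguisher (algA : QAlg (Fin a) (Fin aB ⊕ Fin aC))
    (algD : QAlg (Fin l) (Fin c)) (algC : QAlg (Fin c ⊕ Fin l ⊕ Fin aC) Unit) (T : ℕ) :
    ∃ M : QAlg (Fin a ⊕ Fin c ⊕ Fin l) Unit,
      M.size ≤ 5 * (T * (90 * algC.size + 20 * algD.size + 14) + 3 * algC.size +
        3 * algA.size + 1) + 2 ∧
      ∀ k x z x' z', M.accept (Sum.elim x (Sum.elim z k)) (Sum.elim x' (Sum.elim z' k)) =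
        algA.pull (Matrix.of fun o o' => if o ∘ Sum.inl = o' ∘ Sum.inl then
          (let E := algC.accept.submatrix (withKey k) (withKey k)
           let Q := 1 - (1 : Matrix (Bits (Fin c)) (Bits (Fin c)) ℂ) ⊗ₖ
             averageEffect (fun d z => algD.kraus d z k) E
           Q ^ T * E * Q ^ T) (z, o ∘ Sum.inr) (z', o' ∘ Sum.inr) else 0) x x' := by
  obtain ⟨P, hPs, hP0, hPk⟩ := exists_freshTest algD algC
  have hN : Realizable (1 - P.accept) (2 * P.size) := by
    rw [P.one_sub_accept_eq]
    exact (P.realizable_outcomeOp_false.conjTranspose.mul P.realizable_outcomeOp_false).mono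
      (by omega)
  have hNH : (1 - P.accept)ᴴ = 1 - P.accept := P.one_sub_accept_posSemidef.1
  have hR₀ := algC.realizable_outcomeOp_true.mul (hN.pow T)
  set R₀ := algC.outcomeOp true * (1 - P.accept) ^ T with hR₀def
  have hR₀H : R₀ᴴ * R₀ = (1 - P.accept) ^ T * algC.accept * (1 - P.accept) ^ T := by
    rw [hR₀def, conjTranspose_mul, conjTranspose_pow, hNH, QAlg.accept_eq algC]
    simp only [Matrix.mul_assoc]
  have hinj : ∀ k : Bits (Fin l), Function.Injective (withKey (c := c) (aC := aC) k) := by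
    intro k u v h
    refine Prod.ext ?_ ?_
    · funext x; exact congrFun h (Sum.inl x)
    · funext x; exact congrFun h (Sum.inr (Sum.inr x))
  have hblock : ∀ k, (R₀ᴴ * R₀).submatrix (withKey k) (withKey k) =
      (1 - (1 : Matrix (Bits (Fin c)) (Bits (Fin c)) ℂ) ⊗ₖ
        averageEffect (fun d z => algD.kraus d z k)
          (algC.accept.submatrix (withKey k) (withKey k))) ^ T *
        algC.accept.submatrix (withKey k) (withKey k) *
      (1 - (1 : Matrix (Bits (Fin c)) (Bits (Fin c)) ℂ) ⊗ₖ
        averageEffect (fun d z => algD.kraus d z k)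
          (algC.accept.submatrix (withKey k) (withKey k))) ^ T := by
    intro k
    -- Since the fresh test is block diagonal in the string, taking T-th powers commutes with fixing
    -- `k`.
    rw [hR₀H, submatrix_pow_mul_mul_pow (hinj k) ?_ hNH, ← hPk,
      ← Matrix.submatrix_one _ (hinj k)]
    · rfl
    · intro u x hx
      rw [Matrix.sub_apply, hP0 k u x hx, Matrix.one_apply_ne (fun h => hx ⟨u, h⟩), sub_zero]
  let e : (Fin c ⊕ Fin l ⊕ Fin aC) ⊕ Fin aB ≃ (Fin aB ⊕ Fin aC) ⊕ (Fin c ⊕ Fin l) :=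
    { toFun := fun
        | .inl (.inl x) => .inr (.inl x)
        | .inl (.inr (.inl x)) => .inr (.inr x)
        | .inl (.inr (.inr x)) => .inl (.inr x)
        | .inr x => .inl (.inl x)
      invFun := fun
        | .inr (.inl x) => .inl (.inl x)
        | .inr (.inr x) => .inl (.inr (.inl x))
        | .inl (.inr x) => .inl (.inr (.inr x))
        | .inl (.inl x) => .inr x
      left_inv := by rintro ((x | x | x) | x) <;> rfl
      right_inv := by rintro ((x | x) | x | x) <;> rfl }
  have hR := (hR₀.tensor_one (X := Fin aB)).reindex (Equiv.refl _) e
  obtain ⟨A, hA, hAa⟩ := hR.exists_pull algA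
  obtain ⟨M, hM, hsize⟩ := hA.exists_qalg
  refine ⟨M, ?_, ?_⟩
  · have hcl : c + (l + aC) ≤ algC.size := by
      simp only [QAlg.size, Fintype.card_sum, Fintype.card_fin]; omega
    have haB : aB ≤ algA.size := by
      have := Fintype.card_congr algA.out
      simp only [Fintype.card_sum, Fintype.card_fin] at this
      simp only [QAlg.size, Fintype.card_fin]
      omega
    simp only [Fintype.card_sum, Fintype.card_fin] at hsize
    have hT : T * (2 * P.size) ≤ T * (90 * algC.size + 20 * algD.size + 14) :=
      Nat.mul_le_mul_left _ (by omega)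
    omega
  · intro k x z x' z'
    rw [hM, hAa]
    congr 2
    ext o o'
    have hw : ∀ (o : Bits (Fin aB ⊕ Fin aC)) (z : Bits (Fin c)),
        ((Sum.elim o (Sum.elim z k)) ∘ e) ∘ Sum.inl = withKey k (z, o ∘ Sum.inr) := by
      intro o z
      funext w
      rcases w with w | w | w <;> rfl
    rw [tensorOne_submatrix_conjTranspose_mul]
    simp only [of_apply, submatrix_apply, tensorOne, hw]
    refine if_congr Iff.rfl ?_ rfl
    rw [← hblock]
    rfl

end Distinguisher

/-! ### The quantitative bound and the asymptotic conclusion. -/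

/-- Quantitative form of the simultaneous search lemma. -/
theorem CQOp.exists_distinguisher_simultProb_le {a b c l aB aC : ℕ} {ρ : CQOp a b c l}
    (hρ : ρ.IsState) (algD : QAlg (Fin l) (Fin c)) (algA : QAlg (Fin a) (Fin aB ⊕ Fin aC))
    (algB : QTest (Fin b ⊕ Fin aB)) (algC : QAlg (Fin c ⊕ Fin l ⊕ Fin aC) Unit) (T : ℕ) :
    ∃ M : QAlg (Fin a ⊕ Fin c ⊕ Fin l) Unit,
      M.size ≤ 5 * (T * (90 * algC.size + 20 * algD.size + 14) + 3 * algC.size +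
        3 * algA.size + 1) + 2 ∧
      ρ.simultProb algA algB algC ≤ 2 * ρ.viewProb M +
        2 * T * (ρ.replaceC algD).simultProb algA algB algC ∧
      (ρ.replaceC algD).viewProb M ≤ 1 / (2 * T + 1) := by
  obtain ⟨M, hs, hM⟩ := exists_distinguisher algA algD algC T
  have hE : ∀ k : Bits (Fin l),
      (algC.accept.submatrix (withKey (c := c) k) (withKey k)).PosSemidef := fun k =>
    algC.accept_posSemidef.submatrix _
  have hE1 : ∀ k : Bits (Fin l),
      (1 - algC.accept.submatrix (withKey (c := c) k) (withKey k)).PosSemidef := by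
    intro k
    have hinj : Function.Injective (withKey (c := c) (aC := aC) k) := fun u v h =>
      Prod.ext (funext fun x => congrFun h (Sum.inl x))
        (funext fun x => congrFun h (Sum.inr (Sum.inr x)))
    rw [← Matrix.submatrix_one _ hinj]
    exact algC.one_sub_accept_posSemidef.submatrix _
  refine ⟨M, hs, ?_, ?_⟩
  · rw [viewProb_eq ρ M algA _ hM, simultProb_eq, simultProb_eq, Finset.mul_sum, Finset.mul_sum,
      ← Finset.sum_add_distrib]
    refine Finset.sum_le_sum fun k _ => ?_
    rw [splitState_replaceC]
    exact trace_kronecker_le algB.posSemidef algB.one_sub_posSemidef (hE k) (hE1 k)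
      (splitState_posSemidef hρ algA k) _ (algD.sum_kraus_normSq k) T
  · rw [viewProb_eq _ M algA _ hM]
    calc _ ≤ ∑ k, 1 / (2 * (T : ℝ) + 1) * (ρ.splitState algA k).trace.re := by
          refine Finset.sum_le_sum fun k _ => ?_
          rw [splitState_replaceC]
          exact trace_guarded_replaceState_le (hE k) (hE1 k)
            (splitState_posSemidef hρ algA k) _ (algD.sum_kraus_normSq k) T
      _ = 1 / (2 * (T : ℝ) + 1) := by
          simp only [trace_splitState]
          rw [← Finset.mul_sum, ← Complex.re_sum, hρ.2, Complex.one_re, mul_one]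

theorem Negligible.eventually_le_one_div {f : ℕ → ℝ} (hf : Negligible f) (p : Polynomial ℕ)
    (hp : ∀ n, 0 < p.eval n) : ∀ᶠ n : ℕ in atTop, f n ≤ 1 / ((p.eval n : ℕ) : ℝ) := by
  have h := (Asymptotics.SuperpolynomialDecay.polynomial_mul hf
    (p.map (Nat.castRingHom ℝ))) 0
  simp only [pow_zero, one_mul] at h
  filter_upwards [h.eventually (gt_mem_nhds one_pos)] with n hn
  have hpos : (0 : ℝ) < (p.eval n : ℕ) := by exact_mod_cast hp n
  rw [Polynomial.eval_natCast_map] at hn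
  rw [le_div_iff₀ hpos, mul_comm]
  exact hn.le

theorem lemma4p1
    -- numbers of qubits of the registers `A`, `B`, `C` and length of the string `k_C`
    {a b c l : ℕ → ℕ}
    -- the distributions `D` and `D'`
    (D : ∀ n, CQOp (a n) (b n) (c n) (l n)) (hD : ∀ n, (D n).IsState)
    (D' : ∀ n, QAlg (Fin (l n)) (Fin (c n))) (hD' : IsQPT D')
    (hind : CompIndist D (fun n => (D n).replaceC (D' n)))
    -- the algorithms `A`, `B`, `C`; `A` outputs registers of `aB` and `aC` qubits
    {aB aC : ℕ → ℕ}
    (algA : ∀ n, QAlg (Fin (a n)) (Fin (aB n) ⊕ Fin (aC n))) (hA : IsQPT algA)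
    (algC : ∀ n, QAlg (Fin (c n) ⊕ Fin (l n) ⊕ Fin (aC n)) Unit) (hC : IsQPT algC)
    (algB : ∀ n, QTest (Fin (b n) ⊕ Fin (aB n)))
    (p : Polynomial ℕ) (hp : ∀ n, 0 < p.eval n)
    (hsucc : ∀ᶠ n : ℕ in atTop,
      1 / ((p.eval n : ℕ) : ℝ) ≤ (D n).simultProb (algA n) (algB n) (algC n)) :
    ∃ q : Polynomial ℕ, (∀ n, 0 < q.eval n) ∧
      ∀ᶠ n : ℕ in atTop,
        1 / ((q.eval n : ℕ) : ℝ) ≤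
          ((D n).replaceC (D' n)).simultProb (algA n) (algB n) (algC n) := by
  -- T = 4p(n) makes the guarded test accept a fresh sample with probability at most 1/(8p + 1),
  -- while the circuit stays of polynomial size.
  choose M hMs hM1 hM2 using fun n => CQOp.exists_distinguisher_simultProb_le (hD n) (D' n)
    (algA n) (algB n) (algC n) (4 * p.eval n)
  obtain ⟨PA, hPA⟩ := hA
  obtain ⟨PC, hPC⟩ := hC
  obtain ⟨PD, hPD⟩ := hD'
  have hMq : IsQPT M := by
    refine ⟨5 * ((4 * p) * (90 * PC + 20 * PD + 14) + 3 * PC + 3 * PA + 1) + 2, fun n => ?_⟩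
    refine (hMs n).trans ?_
    simp only [Polynomial.eval_add, Polynomial.eval_mul, Polynomial.eval_ofNat,
      Polynomial.eval_one]
    gcongr
    · exact hPC n
    · exact hPD n
    · exact hPC n
    · exact hPA n
  -- With advantage at most 1/(8p), the guarded term is at most 2(1/(8p) + 1/(8p)) = 1/(2p). Hence
  -- 8p times the modified success is at least 1/(2p).
  refine ⟨16 * p ^ 2, fun n => ?_, ?_⟩
  · have := hp n
    simp only [Polynomial.eval_mul, Polynomial.eval_pow, Polynomial.eval_ofNat]
    positivity
  filter_upwards [hsucc, (hind M hMq).eventually_le_one_div (8 * p) fun n => by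
    have := hp n
    simp only [Polynomial.eval_mul, Polynomial.eval_ofNat]
    positivity] with n hs hadv
  have h1 := hM1 n
  have h2 := hM2 n
  have h3 := (le_abs_self _).trans hadv
  have hpos : (0 : ℝ) < (p.eval n : ℕ) := by exact_mod_cast hp n
  simp only [Polynomial.eval_mul, Polynomial.eval_pow, Polynomial.eval_ofNat] at h3 ⊢
  push_cast at h1 h2 h3 ⊢
  set x : ℝ := ((p.eval n : ℕ) : ℝ)
  have h4 : 1 / (2 * (4 * x) + 1) ≤ 1 / (8 * x) :=
    one_div_le_one_div_of_le (by positivity) (by linarith)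
  have h5 : 1 / (8 * x) = 1 / x / 8 := by field_simp
  have h6 : 1 / x / 2 ≤ 8 * x * ((D n).replaceC (D' n)).simultProb (algA n) (algB n) (algC n) := by
    linarith
  calc 1 / (16 * x ^ 2) = 1 / x / 2 / (8 * x) := by field_simp; norm_num
    _ ≤ _ := by rw [div_le_iff₀ (by positivity)]; linarith
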